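/- Let $U=[0,1]$ and let $g\in L^2(U)$ be a fixed real signal. **Discrete setting.** For $n\ge 1$ let $\mathcal T_n(U)\subset L^2(U)$ be the set of (classes of) functions that are constant on each of the intervals $[\frac{\kappa}{n},\frac{\kappa+1}{n})$, $0\le\kappa\le n-2$, and $[\frac{n-1}{n},1]$. For $f\in L^2(U)$ put $f^\kappa:=n\int_{\kappa/n}^{(\kappa+1)/n}f(s)\,ds$, $0\le\kappa\le n-1$ (for $f\in\mathcal T_n(U)$ this is the value of $f$ on the $\kappa$-th interval). For $\gamma,\mu>0$ define functionals $L^2(U)\to\mathbb R\cup\{\infty\}$, equal to $\infty$ off $\mathcal T_n(U)$ and given for $f\in\mathcal T_n(U)$ by $$\mathrm d_g^n(f)=\frac1n\sum_{\kappa=0}^{n-1}(f^\kappa-g^\kappa)^2,$$ $$\mathrm{BZ}^n_{\gamma,\mu,g}(f)=\sum_{\kappa=0}^{n-2}\min\Big\{\frac{n}{\mu^2}(f^{\kappa+1}-f^\kappa)^2,\gamma\Big\}+\mathrm d_g^n(f),$$ $$\mathrm P^n_{\gamma,g}(f)=\gamma\,\big|\{0\le\kappa\le n-2: f^{\kappa+1}\ne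 f^\kappa\}\big|+\mathrm d_g^n(f).$$ **Continuous setting.** Let $\mathrm{SBV}_2(U)$ be the set of (classes of) right-continuous functions $f$ of bounded variation on $U$, continuous at $1$, whose derivative measure $\nu$ (that is, $\nu((a,b])=f(b)-f(a)$) has the form $\nu=\sum_{x\in p}c_x\delta_x+f'\lambda$, with $p\subset(0,1)$ finite, all $c_x\neq0$, $\lambda$ Lebesgue measure and $f'\in L^2(U)$; put $j(f):=|p|$. Let $\mathcal T(U)$ be the set of (classes of) right-continuous step functions on $U$ with finitely many steps that are continuous at $1$; for $f\in\mathcal T(U)$ let $j(f)$ be the number of discontinuities of $f$ in $(0,1)$. For $\gamma,\mu>0$ define functionals $L^2(U)\to\mathbb R\cup\{\infty\}$ by $$\mathrm{MS}_{\gamma,\mu,g}(f)=\gamma j(f)+\frac1{\mu^2}\int_U|f'|^2\,ds+\|f-g\|^2\ \text{ if } f\in\mathrm{SBV}_2(U),\quad \infty\text{ otherwise},$$ $$\mathrm P_{\gamma,g}(f)=\gamma j(f)+\|f-g\|^2\ \text{ if } f\in\mathcal T(U),\quad \infty\text{ otherwise},$$ $$\mathrm d_g(f)=\int_U(f-g)^2\,ds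 .$$ **The family.** Let $\mathrm T=\{1/n:n=1,2,\dots\}\cup\{0\}$ and let $\mathcal Q=[0,\infty)\times[0,\infty)\times\mathrm T$ carry the topology induced from $\mathbb R^3$. For $q=(\gamma,\mu,t)\in\mathcal Q$, with $t=1/n$ when $t>0$, let $$F(q)=\begin{cases}\mathrm{BZ}^n_{\gamma,\mu,g}&\gamma>0,\ \mu>0,\ t>0,\\ \mathrm{MS}_{\gamma,\mu,g}&\gamma>0,\ \mu>0,\ t=0,\\ \mathrm P^n_{\gamma,g}&\gamma>0,\ \mu=0,\ t>0,\\ \mathrm P_{\gamma,g}&\gamma>0,\ \mu=0,\ t=0,\\ \mathrm d^n_g&\gamma=0,\ t>0,\\ \mathrm d_g&\gamma=0,\ t=0.\end{cases}$$ **Theorem 6.2.** Let $(q_s)_{s\in\mathbb N}$ be a sequence in $\mathcal Q$ converging to $q\in\mathcal Q$. Then $F(q_s)$ $\Gamma$-converges to $F(q)$ in $L^2(U)$ as $s\to\infty$, that is: 1. for all $f\in L^2(U)$ and all sequences $f_s\to f$ in $L^2(U)$, $\;F(q)(f)\le\liminf_{s\to\infty}F(q_s)(f_s)$; 2. for all $f\in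 L^2(U)$ there is a sequence $\hat f_s\to f$ in $L^2(U)$ with $\;F(q)(f)\ge\limsup_{s\to\infty}F(q_s)(\hat f_s)$. -/

import Mathlib

open MeasureTheory Set Filter Topology

namespace Segmentation

/-- The closed unit interval `U = [0, 1]`. -/
abbrev U : Set ℝ := Icc 0 1

/-- The Hilbert space `L²(U)` of classes of square integrable real functions on `U`. -/
abbrev L2U : Type := Lp ℝ 2 (volume.restrict U)

/-! ### Discrete setup -/

/-- `π_n f`: the `κ`-th entry (`0 ≤ κ < n`) is the mean of `f` over `[κ/n, (κ+1)/n)`, that is, the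
value at `κ/n` of the conditional expectation `E(f | σ_n)`. If `f` is `σ_n`-measurable, it is the
value of `f` on that cell. -/
noncomputable def sample (n : ℕ) (f : L2U) (κ : ℕ) : ℝ :=
  n * ∫ s in ((κ : ℝ) / n)..((κ + 1 : ℝ) / n), f s

/-- The atoms `[0, 1/n), …, [(n-2)/n, (n-1)/n), [(n-1)/n, 1]` of `σ_n`. -/
def cell (n κ : ℕ) : Set ℝ :=
  if κ + 1 = n then Icc ((κ : ℝ) / n) 1 else Ico ((κ : ℝ) / n) ((κ + 1 : ℝ) / n)

/-- `τ_n v`: the step function with value `v κ` on the `κ`-th atom of `σ_n`. -/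
noncomputable def stepOf (n : ℕ) (v : ℕ → ℝ) (s : ℝ) : ℝ :=
  ∑ κ ∈ Finset.range n, (cell n κ).indicator (fun _ => v κ) s

/-- `f ∈ 𝒯_n(U)`: the class `f` contains a `σ_n`-measurable function. -/
def IsDiscrete (n : ℕ) (f : L2U) : Prop :=
  ∃ v : ℕ → ℝ, ∀ᵐ s ∂(volume.restrict U), f s = stepOf n v s

/-- `(1/n) ∑_{κ=0}^{n-1} (f - g_n)²(κ/n)` for `f ∈ 𝒯_n(U)`, with `g_n = E(g | σ_n)`. -/
noncomputable def discreteFidelity (n : ℕ) (g f : L2U) : ℝ :=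
  (1 / n : ℝ) * ∑ κ ∈ Finset.range n, (sample n f κ - sample n g κ) ^ 2

open Classical in
/-- The Blake–Zisserman functional `BZ^n_{γ,μ,g}`, for `μ > 0`. -/
noncomputable def blakeZisserman (n : ℕ) (γ μ : ℝ) (g f : L2U) : EReal :=
  if IsDiscrete n f then
    (((∑ κ ∈ Finset.range (n - 1),
        min ((n : ℝ) / μ ^ 2 * (sample n f (κ + 1) - sample n f κ) ^ 2) γ)
      + discreteFidelity n g f : ℝ) : EReal)
  else ⊤

open Classical in
/-- The discrete Potts functional `P^n_{γ,g}`. -/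
noncomputable def discretePotts (n : ℕ) (γ : ℝ) (g f : L2U) : EReal :=
  if IsDiscrete n f then
    ((γ * ((Finset.range (n - 1)).filter
        (fun κ => sample n f (κ + 1) ≠ sample n f κ)).card
      + discreteFidelity n g f : ℝ) : EReal)
  else ⊤

open Classical in
/-- The discrete distance functional `d^n_g`. -/
noncomputable def discreteDistance (n : ℕ) (g f : L2U) : EReal :=
  if IsDiscrete n f then ((discreteFidelity n g f : ℝ) : EReal) else ⊤

/-! ### Functions agreeing almost everywhere on `U` -/

/-- Right-continuous functions on `U`, continuous at `1`, that agree a.e. on `U` agree on `U`. -/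
theorem eqOn_of_ae_eq {r r' : ℝ → ℝ}
    (hr : ∀ x ∈ Ico (0 : ℝ) 1, ContinuousWithinAt r (Icc x 1) x)
    (hr' : ∀ x ∈ Ico (0 : ℝ) 1, ContinuousWithinAt r' (Icc x 1) x)
    (h1 : ContinuousWithinAt r U 1) (h1' : ContinuousWithinAt r' U 1)
    (h : ∀ᵐ s ∂(volume.restrict U), r s = r' s) : EqOn r r' U := by
  have key : ∀ a b x : ℝ, 0 ≤ a → a < b → b ≤ 1 → x ∈ Icc a b →
      (∀ ε > 0, ∃ a' b', a ≤ a' ∧ a' < b' ∧ b' ≤ b ∧ Icc a' b' ⊆ Metric.ball x ε) →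
      ContinuousWithinAt r (Icc a b) x → ContinuousWithinAt r' (Icc a b) x → r x = r' x := by
    intro a b x ha hab hb hx hsub hc hc'
    by_contra hne
    have hd : ContinuousWithinAt (fun y => r y - r' y) (Icc a b) x := hc.sub hc'
    have hev : ∀ᶠ y in 𝓝[Icc a b] x, r y - r' y ≠ 0 :=
      hd.eventually_ne (sub_ne_zero.mpr hne)
    obtain ⟨ε, hε, hball⟩ := Metric.mem_nhdsWithin_iff.mp hev
    obtain ⟨a', b', h1, h2, h3, h4⟩ := hsub ε hε
    rw [ae_restrict_iff' measurableSet_Icc, ae_iff] at h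
    have hle : volume (Icc a' b') ≤ 0 := by
      rw [← h]
      refine measure_mono fun y hy => ?_
      have := hball ⟨h4 hy, ⟨h1.trans hy.1, hy.2.trans h3⟩⟩
      simp only [mem_ofPred_eq, Classical.not_imp] at this ⊢
      exact ⟨⟨ha.trans (h1.trans hy.1), (hy.2.trans h3).trans hb⟩,
        fun he => this (sub_eq_zero.mpr he)⟩
    rw [Real.volume_Icc] at hle
    have := ENNReal.ofReal_pos.mpr (sub_pos.mpr h2)
    exact absurd hle (not_le.mpr this)
  intro x hx
  rcases lt_or_eq_of_le hx.2 with hlt | rfl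
  · refine key x 1 x hx.1 hlt le_rfl ⟨le_rfl, hx.2⟩ (fun ε hε => ?_) (hr x ⟨hx.1, hlt⟩)
      (hr' x ⟨hx.1, hlt⟩)
    refine ⟨x, min 1 (x + ε / 2), le_rfl, lt_min hlt (by linarith), min_le_left _ _, ?_⟩
    intro y hy
    have := hy.2.trans (min_le_right _ _)
    rw [Metric.mem_ball, Real.dist_eq, abs_lt]
    constructor <;> linarith [hy.1]
  · refine key 0 1 1 le_rfl zero_lt_one le_rfl ⟨zero_le_one, le_rfl⟩ (fun ε hε => ?_) h1 h1'
    refine ⟨max 0 (1 - ε / 2), 1, le_max_left _ _, max_lt zero_lt_one (by linarith), le_rfl, ?_⟩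
    intro y hy
    have := (le_max_right _ _).trans hy.1
    rw [Metric.mem_ball, Real.dist_eq, abs_lt]
    constructor <;> linarith [hy.2]

/-! ### Step functions and the continuous Potts functional -/

/-- `t ∈ 𝒯(U)`: `t` is, on `U`, a right-continuous step function that is continuous at `1`.
Step function: off a finite set of break points it is constant on every interval. -/
structure IsStep (t : ℝ → ℝ) : Prop where
  right_cont : ∀ x ∈ Ico (0 : ℝ) 1, ContinuousWithinAt t (Icc x 1) x
  cont_one : ContinuousWithinAt t U 1
  piecewise : ∃ p : Finset ℝ, ∀ x ∈ U, ∀ y ∈ U, x ≤ y → Disjoint (Icc x y) (p : Set ℝ) → t x = t y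

/-- `j(t)`: the number of discontinuities of `t` in `(0, 1)`. -/
noncomputable def numJumps (t : ℝ → ℝ) : ℕ :=
  {x ∈ Ioo (0 : ℝ) 1 | ¬ ContinuousAt t x}.ncard

/-- The number of jumps does not depend on the representative. -/
theorem IsStep.numJumps_eq {t t' : ℝ → ℝ} (ht : IsStep t) (ht' : IsStep t')
    (h : ∀ᵐ s ∂(volume.restrict U), t s = t' s) : numJumps t = numJumps t' := by
  have heq := eqOn_of_ae_eq ht.right_cont ht'.right_cont ht.cont_one ht'.cont_one h
  unfold numJumps
  congr 1
  ext x
  simp only [mem_ofPred_eq, and_congr_right_iff]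
  intro hx
  have : t =ᶠ[𝓝 x] t' :=
    heq.eventuallyEq_of_mem (Icc_mem_nhds hx.1 hx.2)
  rw [continuousAt_congr this]

open Classical in
/-- The Potts functional `P_{γ,g}`: `γ j(t) + ‖t - g‖²` on classes of step functions `t`. -/
noncomputable def potts (γ : ℝ) (g f : L2U) : EReal :=
  if h : ∃ t : ℝ → ℝ, IsStep t ∧ ∀ᵐ s ∂(volume.restrict U), f s = t s then
    ((γ * numJumps h.choose + ‖f - g‖ ^ 2 : ℝ) : EReal)
  else ⊤

/-! ### Functions of special bounded variation and the Mumford–Shah functional -/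

/-- The signed measure `∑_{x ∈ p} c_x δ_x + h λ` on `U`. -/
noncomputable def jumpMeasure (p : Finset ℝ) (c : ℝ → ℝ) (h : L2U) : SignedMeasure ℝ :=
  ∑ x ∈ p, VectorMeasure.dirac x (c x) + (volume.restrict U).withDensityᵥ h

/-- A witness that `f ∈ SBV₂(U)`: a representative `rep` of `f` whose derivative measure `ν`, given
by `ν (a, b] = rep b - rep a`, is `∑_{x ∈ jumps} c_x δ_x + f' λ` with finitely many atoms (with
`c_x ≠ 0`, so that `jumps` is the support of the atomic part) and with `f' ∈ L²(U)`. The atoms lie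
in `(0, 1)`. Bounded variation and right-continuity of `rep` on `U`, and its continuity at `1`,
are consequences. -/
structure SBV₂ (f : L2U) where
  rep : ℝ → ℝ
  jumps : Finset ℝ
  height : ℝ → ℝ
  deriv : L2U
  rep_eq : ∀ᵐ s ∂(volume.restrict U), f s = rep s
  jumps_subset : (jumps : Set ℝ) ⊆ Ioo 0 1
  height_ne : ∀ x ∈ jumps, height x ≠ 0
  measure_eq : ∀ a ∈ U, ∀ b ∈ U, a ≤ b → rep b - rep a = jumpMeasure jumps height deriv (Ioc a b)

theorem integrable_coe (h : L2U) : Integrable h (volume.restrict U) :=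
  (Lp.memLp h).integrable (by norm_num)

theorem sum_dirac_apply (p : Finset ℝ) (c : ℝ → ℝ) {s : Set ℝ} (hs : MeasurableSet s) :
    (∑ x ∈ p, VectorMeasure.dirac x (c x) : SignedMeasure ℝ) s
      = ∑ x ∈ p, s.indicator c x := by
  classical
  induction p using Finset.induction_on with
  | empty => simp
  | insert a p ha ih =>
    rw [Finset.sum_insert ha, Finset.sum_insert ha, _root_.add_apply, ih]
    by_cases hm : a ∈ s
    · simp [hm, hs]
    · simp [hm]

theorem jumpMeasure_apply (p : Finset ℝ) (c : ℝ → ℝ) (h : L2U) {s : Set ℝ}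
    (hs : MeasurableSet s) :
    jumpMeasure p c h s = ∑ x ∈ p, s.indicator c x + ∫ x in s, h x ∂(volume.restrict U) := by
  rw [jumpMeasure, _root_.add_apply, sum_dirac_apply p c hs,
    withDensityᵥ_apply (integrable_coe h) hs]

theorem tendsto_jumpMeasure_Ioc_right (p : Finset ℝ) (c : ℝ → ℝ) (h : L2U) (x : ℝ) :
    Tendsto (fun y => jumpMeasure p c h (Ioc x y)) (𝓝[≥] x) (𝓝 0) := by
  have hind : ∀ z ∈ p, Tendsto (fun y => (Ioc x y).indicator c z) (𝓝[≥] x) (𝓝 0) := by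
    intro z _
    refine Tendsto.congr' ?_ tendsto_const_nhds
    by_cases hz : x < z
    · filter_upwards [mem_nhdsWithin_of_mem_nhds (Iio_mem_nhds hz)] with y hy
      rw [indicator_of_notMem]
      exact fun hm => absurd hm.2 (not_le.mpr hy)
    · filter_upwards with y
      rw [indicator_of_notMem]
      exact fun hm => hz hm.1
  have hint : Tendsto (fun y => ∫ z in Ioc x y, h z ∂(volume.restrict U)) (𝓝[≥] x) (𝓝 0) := by
    have hc := (intervalIntegral.continuous_primitive
      (fun a b => (integrable_coe h).intervalIntegrable) x).tendsto x
    simp only [intervalIntegral.integral_same] at hc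
    refine (hc.mono_left nhdsWithin_le_nhds).congr' ?_
    filter_upwards [self_mem_nhdsWithin] with y hy
    exact intervalIntegral.integral_of_le hy
  have := (tendsto_finsetSum p hind).add hint
  simp only [Finset.sum_const_zero, add_zero] at this
  exact this.congr fun y => (jumpMeasure_apply p c h measurableSet_Ioc).symm

theorem SBV₂.right_cont {f : L2U} (d : SBV₂ f) :
    ∀ x ∈ Ico (0 : ℝ) 1, ContinuousWithinAt d.rep (Icc x 1) x := by
  intro x hx
  have h0 := (tendsto_jumpMeasure_Ioc_right d.jumps d.height d.deriv x).mono_left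
    (nhdsWithin_mono x (Icc_subset_Ici_self : Icc x 1 ⊆ Ici x))
  have h1 := (tendsto_const_nhds (x := d.rep x)).add h0
  rw [add_zero] at h1
  refine h1.congr' ?_
  filter_upwards [self_mem_nhdsWithin] with y hy
  rw [← d.measure_eq x ⟨hx.1, hx.2.le⟩ y ⟨hx.1.trans hy.1, hy.2⟩ hy.1]
  ring

theorem SBV₂.cont_one {f : L2U} (d : SBV₂ f) : ContinuousWithinAt d.rep U 1 := by
  have hind : ∀ z ∈ d.jumps,
      Tendsto (fun y => (Ioc y 1).indicator d.height z) (𝓝[U] 1) (𝓝 0) := by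
    intro z hz
    refine Tendsto.congr' ?_ tendsto_const_nhds
    filter_upwards [mem_nhdsWithin_of_mem_nhds (Ioi_mem_nhds (d.jumps_subset hz).2)] with y hy
    rw [indicator_of_notMem]
    exact fun hm => absurd hm.1 (not_lt.mpr (le_of_lt hy))
  have hint : Tendsto (fun y => ∫ z in Ioc y 1, d.deriv z ∂(volume.restrict U))
      (𝓝[U] 1) (𝓝 0) := by
    have hc : Tendsto (fun y => -∫ z in (1 : ℝ)..y, d.deriv z ∂(volume.restrict U)) (𝓝 1)
        (𝓝 (-∫ z in (1 : ℝ)..1, d.deriv z ∂(volume.restrict U))) :=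
      ((intervalIntegral.continuous_primitive
        (fun a b => (integrable_coe d.deriv).intervalIntegrable) 1).neg).tendsto 1
    rw [intervalIntegral.integral_same, neg_zero] at hc
    refine (hc.mono_left nhdsWithin_le_nhds).congr' ?_
    filter_upwards [self_mem_nhdsWithin] with y hy
    rw [← intervalIntegral.integral_symm, intervalIntegral.integral_of_le hy.2]
  have h0 := (tendsto_finsetSum d.jumps hind).add hint
  simp only [Finset.sum_const_zero, add_zero] at h0
  have h1 := (tendsto_const_nhds (x := d.rep 1)).sub h0
  rw [sub_zero] at h1
  refine h1.congr' ?_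
  filter_upwards [self_mem_nhdsWithin] with y hy
  rw [← jumpMeasure_apply d.jumps d.height d.deriv measurableSet_Ioc,
    ← d.measure_eq y hy 1 ⟨zero_le_one, le_rfl⟩ hy.2]
  ring

theorem SBV₂.boundedVariationOn {f : L2U} (d : SBV₂ f) : BoundedVariationOn d.rep U := by
  let V : ℝ → ℝ := fun y => jumpMeasure d.jumps (fun x => |d.height x|) |d.deriv| (Ioc 0 y)
  have hle : ∀ a ∈ U, ∀ b ∈ U, a ≤ b → |d.rep b - d.rep a| ≤ V b - V a := by
    intro a ha b hb hab
    have hV : V b = V a + jumpMeasure d.jumps (fun x => |d.height x|) |d.deriv| (Ioc a b) := by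
      simp only [V]
      rw [← Ioc_union_Ioc_eq_Ioc ha.1 hab,
        VectorMeasure.of_union (Ioc_disjoint_Ioc_of_le le_rfl) measurableSet_Ioc
          measurableSet_Ioc]
    rw [hV, add_sub_cancel_left, d.measure_eq a ha b hb hab,
      jumpMeasure_apply _ _ _ measurableSet_Ioc, jumpMeasure_apply _ _ _ measurableSet_Ioc]
    refine (abs_add_le _ _).trans (add_le_add ?_ ?_)
    · refine (Finset.abs_sum_le_sum_abs _ _).trans (Finset.sum_le_sum fun x _ => ?_)
      by_cases hx : x ∈ Ioc a b <;> simp [hx]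
    · refine abs_integral_le_integral_abs.trans (le_of_eq ?_)
      refine integral_congr_ae ?_
      exact ae_restrict_of_ae ((Lp.coeFn_abs d.deriv).symm)
  have hmono : MonotoneOn V U := fun a ha b hb hab =>
    sub_nonneg.mp ((abs_nonneg _).trans (hle a ha b hb hab))
  have hV0 : V 0 = 0 := by simp [V]
  have hbv : BoundedVariationOn V U := by
    refine hmono.boundedVariationOn (C := V 1) fun x hx => ?_
    have h0 := hmono (left_mem_Icc.mpr zero_le_one) hx hx.1
    rw [abs_of_nonneg (hV0 ▸ h0)]
    exact hmono hx (right_mem_Icc.mpr zero_le_one) hx.2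
  refine ne_top_of_le_ne_top hbv (iSup_le fun u => ?_)
  refine (Finset.sum_le_sum fun i _ => ?_).trans
    (eVariationOn.sum_le (f := V) (n := u.1) u.2.2.1 u.2.2.2)
  rw [edist_dist, edist_dist, Real.dist_eq, Real.dist_eq]
  exact ENNReal.ofReal_le_ofReal ((hle _ (u.2.2.2 i) _ (u.2.2.2 (i + 1))
    (u.2.2.1 (Nat.le_succ i))).trans (le_abs_self _))

/-- The jump set and the derivative of a function in `SBV₂(U)` are uniquely determined. -/
theorem SBV₂.unique {f : L2U} (d d' : SBV₂ f) : d.jumps = d'.jumps ∧ d.deriv = d'.deriv := by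
  have heq : EqOn d.rep d'.rep U := by
    refine eqOn_of_ae_eq d.right_cont d'.right_cont d.cont_one d'.cont_one ?_
    filter_upwards [d.rep_eq, d'.rep_eq] with s h1 h2
    rw [← h1, h2]
  have hcut : ∀ (e : SBV₂ f) (s : Set ℝ), MeasurableSet s →
      jumpMeasure e.jumps e.height e.deriv s
        = jumpMeasure e.jumps e.height e.deriv (s ∩ Ioc 0 1) := by
    intro e s hs
    rw [jumpMeasure_apply _ _ _ hs, jumpMeasure_apply _ _ _ (hs.inter measurableSet_Ioc)]
    congr 1
    · refine Finset.sum_congr rfl fun x hx => ?_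
      have hx' : x ∈ Ioc (0 : ℝ) 1 := Ioo_subset_Ioc_self (e.jumps_subset hx)
      by_cases hxs : x ∈ s
      · rw [indicator_of_mem hxs, indicator_of_mem (mem_inter hxs hx')]
      · rw [indicator_of_notMem hxs, indicator_of_notMem fun h => hxs h.1]
    · refine setIntegral_congr_set ?_
      have h0 : ∀ᵐ x ∂(volume.restrict U), x ≠ 0 := by
        rw [ae_iff]
        simp
      filter_upwards [ae_restrict_mem measurableSet_Icc, h0] with x hx hx0
      have hx' : x ∈ Ioc (0 : ℝ) 1 := ⟨lt_of_le_of_ne hx.1 hx0.symm, hx.2⟩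
      exact propext ⟨fun h => ⟨h, hx'⟩, fun h => h.1⟩
  have hIoc : ∀ a b : ℝ, jumpMeasure d.jumps d.height d.deriv (Ioc a b)
      = jumpMeasure d'.jumps d'.height d'.deriv (Ioc a b) := by
    intro a b
    rw [hcut d _ measurableSet_Ioc, hcut d' _ measurableSet_Ioc, Ioc_inter_Ioc]
    rcases le_or_gt (a ⊔ 0) (b ⊓ 1) with hab | hab
    · have ha : a ⊔ 0 ∈ U := ⟨le_max_right _ _, hab.trans (min_le_right _ _)⟩
      have hb : b ⊓ 1 ∈ U := ⟨(le_max_right _ _).trans hab, min_le_right _ _⟩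
      rw [← d.measure_eq _ ha _ hb hab, ← d'.measure_eq _ ha _ hb hab, heq ha, heq hb]
    · rw [Ioc_eq_empty (not_lt.mpr hab.le)]
      simp
  have hν : jumpMeasure d.jumps d.height d.deriv = jumpMeasure d'.jumps d'.height d'.deriv := by
    refine VectorMeasure.ext_of_generateFrom {S | ∃ l u, l < u ∧ Ioc l u = S} ?_
      (BorelSpace.measurable_eq.trans (borel_eq_generateFrom_Ioc ℝ)) ?_ ?_
    · rintro s ⟨l, u, _, rfl⟩
      exact hIoc l u
    · exact isPiSystem_Ioc id id
    · rw [hcut d _ MeasurableSet.univ, hcut d' _ MeasurableSet.univ, univ_inter, hIoc]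
  have hatom : ∀ (e : SBV₂ f) (x : ℝ), jumpMeasure e.jumps e.height e.deriv {x}
      = if x ∈ e.jumps then e.height x else 0 := by
    intro e x
    rw [jumpMeasure_apply _ _ _ (measurableSet_singleton x)]
    have h0 : ∫ z in {x}, e.deriv z ∂(volume.restrict U) = 0 := by
      refine setIntegral_measure_zero _ ?_
      exact measure_singleton x
    rw [h0, add_zero]
    simp only [indicator_apply, mem_singleton_iff]
    exact Finset.sum_ite_eq' e.jumps x e.height
  have hif : ∀ x, (if x ∈ d.jumps then d.height x else 0)
      = if x ∈ d'.jumps then d'.height x else 0 := by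
    intro x
    rw [← hatom d, ← hatom d', hν]
  have hjumps : d.jumps = d'.jumps := by
    ext x
    have hx := hif x
    constructor
    · intro h
      by_contra h'
      rw [if_pos h, if_neg h'] at hx
      exact d.height_ne x h hx
    · intro h
      by_contra h'
      rw [if_neg h', if_pos h] at hx
      exact d'.height_ne x h hx.symm
  refine ⟨hjumps, ?_⟩
  have hsum : (∑ x ∈ d.jumps, VectorMeasure.dirac x (d.height x) : SignedMeasure ℝ)
      = ∑ x ∈ d'.jumps, VectorMeasure.dirac x (d'.height x) := by
    rw [← hjumps]
    refine Finset.sum_congr rfl fun x hx => ?_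
    have h := hif x
    rw [if_pos hx, if_pos (hjumps ▸ hx)] at h
    rw [h]
  rw [jumpMeasure, jumpMeasure, hsum] at hν
  exact Lp.ext ((integrable_coe _).ae_eq_of_withDensityᵥ_eq (integrable_coe _)
    (add_left_cancel hν))

open Classical in
/-- The Mumford–Shah functional `MS_{γ,μ,g}`, for `μ > 0`:
`γ j(f) + μ⁻² ∫ |f'|² + ‖f - g‖²` on `SBV₂(U)`. -/
noncomputable def mumfordShah (γ μ : ℝ) (g f : L2U) : EReal :=
  if h : Nonempty (SBV₂ f) then
    ((γ * h.some.jumps.card + 1 / μ ^ 2 * (∫ s in U, (h.some.deriv s) ^ 2)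
      + ‖f - g‖ ^ 2 : ℝ) : EReal)
  else ⊤

/-- The continuous distance functional `d_g(f) = ∫_U (f - g)² ds`. -/
noncomputable def distance (g f : L2U) : EReal := ((‖f - g‖ ^ 2 : ℝ) : EReal)

/-! ### The parameter cube and the family of functionals -/

/-- `T = {1/n : n = 1, 2, …} ∪ {0}`. -/
def samplingParam : Set ℝ := {t | t = 0 ∨ ∃ n : ℕ, 1 ≤ n ∧ t = 1 / n}

/-- The cube `ℝ₀⁺ × ℝ₀⁺ × T`, with the topology induced from `ℝ³`. -/
abbrev Cube : Type := {q : ℝ × ℝ × ℝ // 0 ≤ q.1 ∧ 0 ≤ q.2.1 ∧ q.2.2 ∈ samplingParam}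

/-- The number `n` with `t = 1/n`, for `t ∈ T`, `t > 0`. -/
noncomputable def sampleSize (t : ℝ) : ℕ := ⌊1 / t⌋₊

theorem sampleSize_one_div (n : ℕ) : sampleSize (1 / n) = n := by
  simp [sampleSize]

open Classical in
/-- The functional `F(γ, μ, t)` for the signal `g`. -/
noncomputable def F (g : L2U) (q : Cube) : L2U → EReal :=
  let γ := q.1.1
  let μ := q.1.2.1
  let t := q.1.2.2
  if 0 < γ then
    if 0 < μ then
      if 0 < t then blakeZisserman (sampleSize t) γ μ g else mumfordShah γ μ g
    else
      if 0 < t then discretePotts (sampleSize t) γ g else potts γ g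
  else
    if 0 < t then discreteDistance (sampleSize t) g else distance g

/-- `Γ`-convergence of a sequence of extended real functions on a metric space. -/
def GammaConverges {X : Type*} [MetricSpace X] (Fs : ℕ → X → EReal) (Flim : X → EReal) : Prop :=
  (∀ x : X, ∀ u : ℕ → X, Tendsto u atTop (𝓝 x) →
    Flim x ≤ liminf (fun j => Fs j (u j)) atTop) ∧
  (∀ x : X, ∃ u : ℕ → X, Tendsto u atTop (𝓝 x) ∧
    limsup (fun j => Fs j (u j)) atTop ≤ Flim x)

end Segmentation

/-!
The six kinds of functionals in the family are brought to two forms. On a grid, `F g q` is the sum of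
a bond energy (`bondEnergy`: a truncated parabola, or `γ · 1_{δ ≠ 0}` when `μ = 0`) and a data term
(`F_of_isDiscrete`). In the continuum with `γ > 0`, it is the Mumford–Shah energy of an `SBV₂`
function, where `μ = 0` stands for the constraint `f' = 0`, since step functions are exactly the
functions in `SBV₂(U)` with zero derivative (`IsStep.exists_sbv`, `SBV₂.isStep`,
`exists_sbv_of_F_le`, `F_le_of_sbv`). The data term is always the squared distance to
`sampledSignal g t`, and this signal converges to `g` as `t → 0` (`tendsto_sampledSignal`).

**Lower bound.** If it fails, the energies stay below a constant `c < F(q)(f)` along an ultrafilter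
along which the functions also converge almost everywhere (`exists_ultrafilter_tendsto_ae`). Positive
sampling parameters are isolated, so a limit with `t > 0` reduces to the semicontinuity of the bond
energies in finitely many variables. For `γ = 0` and `t = 0` the data term suffices. In the remaining
case an energy bound makes each function, whether on a grid or in the continuum, an approximate
primitive of some `h` off a finite set `J`, with control on `|J|` and `‖h‖`
(`exists_approx_primitive_of_F_le`). Along the ultrafilter the points of `J` converge by compactness of
`U`, and the `h` converge weakly. The limit minus the primitive of the weak limit is locally constant
off the limit points, hence a step function; so the limit is in `SBV₂(U)` with at most as many jumps
and no larger derivative (`exists_sbv_of_tendsto`).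

**Recovery.** For limits with `t > 0` the function itself serves. For `t = 0`, an `SBV₂` function is
sampled at the grid points: each jump is crossed by one bond, and by the Cauchy–Schwarz inequality the
other bonds cost at most the integral of the squared derivative (`SBV₂.gridEnergy_le`). For `γ = 0` the
function is first approximated by a step function, whose jumps cost nothing in the limit. A diagonal
argument (`exists_seq_limsup_le`) turns approximate recovery into a recovery sequence.
-/

namespace Segmentation

/-! ### Cells of the uniform grid -/

/-- The index of the atom of `σ_n` that contains the point `x ∈ U`. The minimum puts the point `1`
into the last atom. -/
noncomputable def cellIndex (n : ℕ) (x : ℝ) : ℕ := min ⌊n * x⌋₊ (n - 1)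

theorem cellIndex_lt {n : ℕ} (hn : 1 ≤ n) (x : ℝ) : cellIndex n x < n :=
  (min_le_right _ _).trans_lt (by omega)

theorem cellIndex_mono (n : ℕ) {x y : ℝ} (hxy : x ≤ y) : cellIndex n x ≤ cellIndex n y := by
  unfold cellIndex
  gcongr

theorem cellIndex_div_le {n : ℕ} (hn : 1 ≤ n) {x : ℝ} (hx : x ∈ U) :
    (cellIndex n x : ℝ) / n ≤ x := by
  have hn' : (0 : ℝ) < n := by exact_mod_cast hn
  rw [div_le_iff₀ hn', mul_comm]
  exact le_trans (by exact_mod_cast min_le_left _ _)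
    (Nat.floor_le (mul_nonneg hn'.le hx.1))

theorem lt_cellIndex_add_one_div {n : ℕ} (hn : 1 ≤ n) {x : ℝ} (hx : x < 1) :
    x < ((cellIndex n x : ℝ) + 1) / n := by
  have hn' : (0 : ℝ) < n := by exact_mod_cast hn
  rw [lt_div_iff₀ hn', mul_comm]
  rcases min_cases ⌊n * x⌋₊ (n - 1) with ⟨h, _⟩ | ⟨h, _⟩
  · rw [cellIndex, h]
    exact Nat.lt_floor_add_one _
  · rw [cellIndex, h, Nat.cast_sub hn]
    push_cast
    nlinarith

theorem le_cellIndex_add_one_div {n : ℕ} (hn : 1 ≤ n) {x : ℝ} (hx : x ∈ U) :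
    x ≤ ((cellIndex n x : ℝ) + 1) / n := by
  have hn' : (0 : ℝ) < n := by exact_mod_cast hn
  rcases lt_or_eq_of_le hx.2 with h | rfl
  · exact (lt_cellIndex_add_one_div hn h).le
  · rw [cellIndex, mul_one, Nat.floor_natCast, min_eq_right (by omega), Nat.cast_sub hn,
      le_div_iff₀ hn']
    push_cast
    linarith

theorem div_mem_U {n k : ℕ} (hk : k ≤ n) : (k : ℝ) / n ∈ U :=
  ⟨by positivity, div_le_one_of_le₀ (by exact_mod_cast hk) (by positivity)⟩

theorem measurableSet_cell (n κ : ℕ) : MeasurableSet (cell n κ) := by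
  unfold cell
  split_ifs
  · exact measurableSet_Icc
  · exact measurableSet_Ico

theorem mem_cell_iff {n κ : ℕ} (hκ : κ < n) {x : ℝ} (hx : x ∈ U) :
    x ∈ cell n κ ↔ cellIndex n x = κ := by
  have hn : 1 ≤ n := by omega
  have hn' : (0 : ℝ) < n := by exact_mod_cast hn
  constructor
  · intro h
    rw [cell] at h
    rw [cellIndex]
    split_ifs at h with he
    · rw [min_eq_right, ← he, Nat.add_sub_cancel]
      rw [Nat.le_floor_iff (mul_nonneg hn'.le hx.1)]
      have := h.1
      rw [div_le_iff₀ hn'] at this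
      rw [show n - 1 = κ by omega]
      linarith
    · have h1 := h.1
      have h2 := h.2
      rw [div_le_iff₀ hn'] at h1
      rw [lt_div_iff₀ hn'] at h2
      have : ⌊n * x⌋₊ = κ := by
        rw [Nat.floor_eq_iff (mul_nonneg hn'.le hx.1)]
        constructor <;> linarith
      rw [this, min_eq_left (by omega)]
  · rintro rfl
    have h1 := cellIndex_div_le hn hx
    rw [cell]
    split_ifs with he
    · exact ⟨h1, hx.2⟩
    · refine ⟨h1, lt_cellIndex_add_one_div hn (lt_of_le_of_ne hx.2 ?_)⟩
      rintro rfl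
      apply he
      rw [cellIndex, mul_one, Nat.floor_natCast, min_eq_right (by omega)]
      omega

theorem stepOf_apply {n : ℕ} (hn : 1 ≤ n) (v : ℕ → ℝ) {x : ℝ} (hx : x ∈ U) :
    stepOf n v x = v (cellIndex n x) := by
  rw [stepOf, Finset.sum_eq_single (cellIndex n x)]
  · rw [indicator_of_mem ((mem_cell_iff (cellIndex_lt hn x) hx).mpr rfl)]
  · intro κ hκ hne
    rw [indicator_of_notMem]
    rw [mem_cell_iff (Finset.mem_range.mp hκ) hx]
    exact hne.symm
  · exact fun h => absurd (Finset.mem_range.mpr (cellIndex_lt hn x)) h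

theorem cell_ae_eq {n κ : ℕ} (hκ : κ < n) :
    cell n κ =ᵐ[volume] Ioc ((κ : ℝ) / n) ((κ + 1 : ℝ) / n) := by
  have hn' : (0 : ℝ) < n := by exact_mod_cast (show 0 < n by omega)
  unfold cell
  split_ifs with he
  · have : ((κ + 1 : ℝ) / n) = 1 := by
      rw [← he]
      push_cast
      exact div_self (by positivity)
    rw [this]
    exact Ioc_ae_eq_Icc.symm
  · exact Ico_ae_eq_Ioc

theorem cell_subset_U {n κ : ℕ} (hκ : κ < n) : cell n κ ⊆ U := by
  intro x hx
  have h0 : (0 : ℝ) ≤ (κ : ℝ) / n := by positivity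
  unfold cell at hx
  split_ifs at hx
  · exact ⟨h0.trans hx.1, hx.2⟩
  · have := (div_mem_U (n := n) (k := κ + 1) hκ).2
    push_cast at this
    exact ⟨h0.trans hx.1, hx.2.le.trans this⟩

theorem restrict_restrict_cell {n κ : ℕ} (hκ : κ < n) :
    (volume.restrict U).restrict (cell n κ)
      = volume.restrict (Ioc ((κ : ℝ) / n) ((κ + 1 : ℝ) / n)) := by
  rw [Measure.restrict_restrict (measurableSet_cell n κ),
    inter_eq_left.mpr (cell_subset_U hκ), Measure.restrict_congr_set (cell_ae_eq hκ)]

theorem div_le_add_one_div (n κ : ℕ) : (κ : ℝ) / n ≤ (κ + 1 : ℝ) / n := by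
  gcongr
  linarith

theorem setIntegral_cell {n κ : ℕ} (hκ : κ < n) (f : L2U) :
    ∫ x in cell n κ, f x ∂(volume.restrict U) = 1 / n * sample n f κ := by
  have hn' : (n : ℝ) ≠ 0 := by exact_mod_cast (show n ≠ 0 by omega)
  rw [restrict_restrict_cell hκ, sample, intervalIntegral.integral_of_le (div_le_add_one_div n κ)]
  field_simp

/-! ### Step functions on the grid as elements of `L²(U)` -/

/-- The class in `L²(U)` of the step function `stepOf n v`. -/
noncomputable def stepLp (n : ℕ) (v : ℕ → ℝ) : L2U :=
  ∑ κ ∈ Finset.range n,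
    v κ • indicatorConstLp 2 (measurableSet_cell n κ) (measure_ne_top (volume.restrict U) _) (1 : ℝ)

theorem coeFn_stepLp (n : ℕ) (v : ℕ → ℝ) : stepLp n v =ᵐ[volume.restrict U] stepOf n v := by
  unfold stepLp
  refine (Lp.coeFn_finsetSum _ _).trans ?_
  have h : ∀ κ : ℕ, ∀ᵐ s ∂(volume.restrict U), (v κ • indicatorConstLp 2 (measurableSet_cell n κ)
      (measure_ne_top (volume.restrict U) _) (1 : ℝ) : L2U) s
      = (cell n κ).indicator (fun _ => v κ) s := by
    intro κ
    filter_upwards [Lp.coeFn_smul (v κ) (indicatorConstLp 2 (measurableSet_cell n κ)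
      (measure_ne_top (volume.restrict U) _) (1 : ℝ)), indicatorConstLp_coeFn (p := 2)
      (hs := measurableSet_cell n κ) (hμs := measure_ne_top (volume.restrict U) _) (c := (1 : ℝ))]
      with s h1 h2
    rw [h1, Pi.smul_apply, h2]
    by_cases hs : s ∈ cell n κ <;> simp [hs]
  filter_upwards [ae_all_iff.mpr h] with s hs
  simp only [Finset.sum_apply, stepOf, hs]

theorem isDiscrete_iff {n : ℕ} {f : L2U} : IsDiscrete n f ↔ ∃ v, f = stepLp n v :=
  exists_congr fun v => ⟨fun h => Lp.ext (EventuallyEq.trans h (coeFn_stepLp n v).symm),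
    fun h => h ▸ coeFn_stepLp n v⟩

theorem inner_stepLp (n : ℕ) (v : ℕ → ℝ) (f : L2U) :
    inner ℝ (stepLp n v) f = 1 / n * ∑ κ ∈ Finset.range n, v κ * sample n f κ := by
  rw [stepLp, sum_inner, Finset.mul_sum]
  refine Finset.sum_congr rfl fun κ hκ => ?_
  rw [real_inner_smul_left, L2.inner_indicatorConstLp_one,
    setIntegral_cell (Finset.mem_range.mp hκ)]
  ring

theorem ae_restrict_cell {n κ : ℕ} (hκ : κ < n) (v : ℕ → ℝ) :
    ∀ᵐ x ∂((volume.restrict U).restrict (cell n κ)), stepLp n v x = v κ := by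
  filter_upwards [ae_restrict_of_ae (coeFn_stepLp n v), ae_restrict_mem (measurableSet_cell n κ)]
    with x h1 h2
  have hx := cell_subset_U hκ h2
  rw [h1, stepOf_apply (by omega) v hx, (mem_cell_iff hκ hx).mp h2]

theorem sample_stepLp {n κ : ℕ} (hκ : κ < n) (v : ℕ → ℝ) : sample n (stepLp n v) κ = v κ := by
  have hn' : (n : ℝ) ≠ 0 := by exact_mod_cast (show n ≠ 0 by omega)
  have h := ae_restrict_cell hκ v
  rw [restrict_restrict_cell hκ] at h
  rw [sample, intervalIntegral.integral_of_le (div_le_add_one_div n κ), integral_congr_ae h,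
    ← intervalIntegral.integral_of_le (div_le_add_one_div n κ), intervalIntegral.integral_const,
    smul_eq_mul]
  field_simp
  ring

theorem inner_stepLp_stepLp (n : ℕ) (v w : ℕ → ℝ) :
    inner ℝ (stepLp n v) (stepLp n w) = 1 / n * ∑ κ ∈ Finset.range n, v κ * w κ := by
  rw [inner_stepLp]
  congr 1
  exact Finset.sum_congr rfl fun κ hκ => by rw [sample_stepLp (Finset.mem_range.mp hκ)]

theorem norm_stepLp_sq (n : ℕ) (v : ℕ → ℝ) :
    ‖stepLp n v‖ ^ 2 = 1 / n * ∑ κ ∈ Finset.range n, v κ ^ 2 := by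
  rw [← real_inner_self_eq_norm_sq, inner_stepLp_stepLp]
  simp only [sq]

theorem stepLp_sub (n : ℕ) (v w : ℕ → ℝ) :
    stepLp n v - stepLp n w = stepLp n (fun κ => v κ - w κ) := by
  simp only [stepLp, sub_smul, Finset.sum_sub_distrib]

theorem stepLp_congr {n : ℕ} {v w : ℕ → ℝ} (h : ∀ κ < n, v κ = w κ) : stepLp n v = stepLp n w :=
  Finset.sum_congr rfl fun κ hκ => by rw [h κ (Finset.mem_range.mp hκ)]

theorem IsDiscrete.stepLp_sample {n : ℕ} {f : L2U} (hf : IsDiscrete n f) :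
    stepLp n (sample n f) = f := by
  obtain ⟨v, rfl⟩ := isDiscrete_iff.mp hf
  exact stepLp_congr fun κ hκ => sample_stepLp hκ v

theorem IsDiscrete.fidelity_eq {n : ℕ} {f : L2U} (hf : IsDiscrete n f) (g : L2U) :
    discreteFidelity n g f = ‖f - stepLp n (sample n g)‖ ^ 2 := by
  conv_rhs => rw [← hf.stepLp_sample]
  rw [stepLp_sub, norm_stepLp_sq, discreteFidelity]

/-- The mean value projection is the best approximation by step functions on the grid. -/
theorem norm_sub_stepLp_sample_le (n : ℕ) (f : L2U) (v : ℕ → ℝ) :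
    ‖f - stepLp n (sample n f)‖ ≤ ‖f - stepLp n v‖ := by
  have h : inner ℝ (f - stepLp n (sample n f)) (stepLp n (fun κ => sample n f κ - v κ)) = 0 := by
    rw [inner_sub_left, real_inner_comm, inner_stepLp, inner_stepLp_stepLp, sub_eq_zero]
    simp only [mul_comm]
  have h2 : f - stepLp n v
      = (f - stepLp n (sample n f)) + stepLp n (fun κ => sample n f κ - v κ) := by
    rw [← stepLp_sub]
    abel
  have h3 := norm_add_sq_eq_norm_sq_add_norm_sq_of_inner_eq_zero _ _ h
  rw [← h2] at h3
  nlinarith [norm_nonneg (f - stepLp n (sample n f)), norm_nonneg (f - stepLp n v),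
    mul_self_nonneg ‖stepLp n (fun κ => sample n f κ - v κ)‖]

theorem continuous_sample {n κ : ℕ} (hκ : κ < n) : Continuous fun f => sample n f κ := by
  have hn' : (n : ℝ) ≠ 0 := by exact_mod_cast (show n ≠ 0 by omega)
  have h : (fun f : L2U => sample n f κ) = fun f => n * inner ℝ (indicatorConstLp 2
      (measurableSet_cell n κ) (measure_ne_top (volume.restrict U) _) (1 : ℝ)) f := by
    ext f
    rw [L2.inner_indicatorConstLp_one, setIntegral_cell hκ]
    field_simp
  rw [h]
  fun_prop

theorem isClosed_isDiscrete (n : ℕ) : IsClosed {f | IsDiscrete n f} := by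
  have h : {f | IsDiscrete n f} = {f | stepLp n (sample n f) = f} := by
    ext f
    exact ⟨fun hf => hf.stepLp_sample, fun hf => isDiscrete_iff.mpr ⟨_, hf.symm⟩⟩
  rw [h]
  refine isClosed_eq (continuous_finsetSum _ fun κ hκ => ?_) continuous_id
  exact (continuous_sample (Finset.mem_range.mp hκ)).smul continuous_const

/-! ### Approximation by step functions on fine grids -/

theorem norm_sq_eq_integral (f : L2U) : ‖f‖ ^ 2 = ∫ x in U, f x ^ 2 := by
  rw [← real_inner_self_eq_norm_sq, L2.inner_def]
  simp [sq]

theorem tendsto_cellIndex_div {x : ℝ} (hx : x ∈ U) :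
    Tendsto (fun n : ℕ => (cellIndex n x : ℝ) / n) atTop (𝓝 x) := by
  have h1 : Tendsto (fun n : ℕ => x - 1 / (n : ℝ)) atTop (𝓝 x) := by
    simpa using (tendsto_const_nhds (x := x)).sub (tendsto_one_div_atTop_nhds_zero_nat (𝕜 := ℝ))
  refine tendsto_of_tendsto_of_tendsto_of_le_of_le' h1 tendsto_const_nhds ?_ ?_
  · filter_upwards [eventually_ge_atTop 1] with n hn
    have := le_cellIndex_add_one_div hn hx
    rw [add_div] at this
    linarith
  · filter_upwards [eventually_ge_atTop 1] with n hn
    exact cellIndex_div_le hn hx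

/-- Sampling a bounded, almost everywhere continuous function at the grid points approximates it in
`L²(U)`. -/
theorem tendsto_stepLp_of_continuousAt {w : L2U} {r : ℝ → ℝ} {M : ℝ}
    (hw : ∀ᵐ x ∂(volume.restrict U), w x = r x) (hM : ∀ x ∈ U, |r x| ≤ M)
    (hr : ∀ᵐ x ∂(volume.restrict U), ContinuousWithinAt r U x) :
    Tendsto (fun n => stepLp n fun κ => r (κ / n)) atTop (𝓝 w) := by
  rw [tendsto_iff_norm_sub_tendsto_zero]
  have key : Tendsto (fun n => ‖stepLp n (fun κ => r (κ / n)) - w‖ ^ 2) atTop (𝓝 0) := by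
    simp only [norm_sq_eq_integral]
    have h0 : (0 : ℝ) = ∫ x in U, (0 : ℝ) := by simp
    rw [h0, ← tendsto_add_atTop_iff_nat 1]
    refine tendsto_integral_of_dominated_convergence (fun _ => (2 * M) ^ 2) ?_
      (integrable_const _) ?_ ?_
    · intro n
      exact ((Lp.memLp _).aestronglyMeasurable).pow 2
    · intro n
      filter_upwards [hw, Lp.coeFn_sub (stepLp (n + 1) fun κ => r (κ / (n + 1 : ℕ))) w,
        coeFn_stepLp (n + 1) fun κ => r (κ / (n + 1 : ℕ)), ae_restrict_mem measurableSet_Icc]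
        with x h1 h2 h3 hx
      rw [h2, Pi.sub_apply, h3, h1, stepOf_apply (by omega) _ hx, Real.norm_eq_abs, abs_pow]
      gcongr
      refine (abs_sub _ _).trans ?_
      have := hM x hx
      have := hM _ (div_mem_U (cellIndex_lt (Nat.succ_pos n) x).le)
      push_cast at this ⊢
      linarith
    · have h2 : ∀ n : ℕ, ∀ᵐ x ∂(volume.restrict U),
          (stepLp n (fun κ => r (κ / n)) - w) x = stepOf n (fun κ => r (κ / n)) x - w x := by
        intro n
        filter_upwards [Lp.coeFn_sub (stepLp n fun κ => r (κ / n)) w,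
          coeFn_stepLp n fun κ => r (κ / n)] with x h2 h3
        rw [h2, Pi.sub_apply, h3]
      filter_upwards [hw, ae_all_iff.mpr h2, hr, ae_restrict_mem measurableSet_Icc]
        with x h1 h2 h3 hx
      have h4 : Tendsto (fun n : ℕ => r ((cellIndex n x : ℝ) / n)) atTop (𝓝 (r x)) := by
        refine h3.tendsto.comp (tendsto_nhdsWithin_iff.mpr ⟨tendsto_cellIndex_div hx, ?_⟩)
        filter_upwards [eventually_ge_atTop 1] with n hn
        exact div_mem_U (cellIndex_lt hn x).le
      have h5 := ((h4.sub_const (r x)).pow 2)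
      rw [sub_self, zero_pow two_ne_zero, ← tendsto_add_atTop_iff_nat 1] at h5
      refine h5.congr fun n => ?_
      rw [h2, h1, stepOf_apply (by omega) _ hx]
  have := key.sqrt
  simpa [Real.sqrt_sq (norm_nonneg _)] using this

/-- Mean values on fine grids approximate in `L²(U)`. -/
theorem tendsto_stepLp_sample (g : L2U) :
    Tendsto (fun n => stepLp n (sample n g)) atTop (𝓝 g) := by
  rw [Metric.tendsto_atTop']
  intro ε hε
  obtain ⟨w, hwd, hw⟩ := Metric.mem_closure_iff.mp
    ((Lp.boundedContinuousFunction_dense ℝ (volume.restrict U) (p := 2) (by norm_num)).closure_eq ▸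
      mem_univ g) (ε / 2) (half_pos hε)
  obtain ⟨r, hr⟩ := hwd
  have hr' : ∀ᵐ x ∂(volume.restrict U), w x = r x := by
    have h1 := ContinuousMap.coeFn_toAEEqFun (volume.restrict U) r.toContinuousMap
    filter_upwards [h1] with x hx
    have h2 : (w : ℝ →ₘ[volume.restrict U] ℝ)
        = ContinuousMap.toAEEqFun (volume.restrict U) r.toContinuousMap := hr.symm
    rw [h2]
    exact hx
  have h1 := tendsto_stepLp_of_continuousAt hr' (fun x _ => r.norm_coe_le_norm x)
    (Eventually.of_forall fun x => r.continuous.continuousWithinAt)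
  obtain ⟨N, hN⟩ := Metric.tendsto_atTop'.mp h1 (ε / 2) (half_pos hε)
  refine ⟨N, fun n hn => ?_⟩
  rw [dist_comm, dist_eq_norm]
  refine (norm_sub_stepLp_sample_le n g fun κ => r (κ / n)).trans_lt ?_
  rw [← dist_eq_norm]
  have h2 := dist_triangle g w (stepLp n fun κ => r (κ / n))
  have h3 := hN n hn
  rw [dist_comm] at h3
  linarith

/-! ### Primitives of functions in `L²(U)` -/

theorem Ioc_subset_U {a b : ℝ} (ha : a ∈ U) (hb : b ∈ U) : Ioc a b ⊆ U :=
  fun _ hx => ⟨ha.1.trans hx.1.le, hx.2.trans hb.2⟩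

theorem setIntegral_Ioc_eq {a b : ℝ} (ha : a ∈ U) (hb : b ∈ U) (hab : a ≤ b) (h : L2U) :
    ∫ x in Ioc a b, h x ∂(volume.restrict U) = ∫ x in a..b, h x := by
  rw [Measure.restrict_restrict measurableSet_Ioc, inter_eq_left.mpr (Ioc_subset_U ha hb),
    intervalIntegral.integral_of_le hab]

theorem intervalIntegrable_coe {a b : ℝ} (ha : a ∈ U) (hb : b ∈ U) (h : L2U) :
    IntervalIntegrable h volume a b :=
  intervalIntegrable_iff.mpr (IntegrableOn.mono_set (integrable_coe h)
    (Ioc_subset_U (by rcases min_choice a b with e | e <;> rwa [e])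
      (by rcases max_choice a b with e | e <;> rwa [e])))

theorem integral_sub_integral {a b : ℝ} (ha : a ∈ U) (hb : b ∈ U) (h : L2U) :
    (∫ x in (0 : ℝ)..b, h x) - ∫ x in (0 : ℝ)..a, h x = ∫ x in a..b, h x := by
  have h0 : (0 : ℝ) ∈ U := ⟨le_rfl, zero_le_one⟩
  exact intervalIntegral.integral_interval_sub_left (intervalIntegrable_coe h0 hb h)
    (intervalIntegrable_coe h0 ha h)

/-- The indicator of `(a, b]` in `L²(U)`, which represents the functional `h ↦ ∫ₐᵇ h`. -/
noncomputable def iocLp (a b : ℝ) : L2U :=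
  indicatorConstLp 2 measurableSet_Ioc (measure_ne_top (volume.restrict U) (Ioc a b)) (1 : ℝ)

theorem inner_iocLp {a b : ℝ} (ha : a ∈ U) (hb : b ∈ U) (hab : a ≤ b) (h : L2U) :
    inner ℝ (iocLp a b) h = ∫ x in a..b, h x := by
  rw [iocLp, L2.inner_indicatorConstLp_one, setIntegral_Ioc_eq ha hb hab]

theorem abs_integral_le {a b : ℝ} (ha : a ∈ U) (hb : b ∈ U) (hab : a ≤ b) (h : L2U) :
    |∫ x in a..b, h x| ≤ √(b - a) * ‖h‖ := by
  rw [← inner_iocLp ha hb hab]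
  refine (abs_real_inner_le_norm _ _).trans_eq ?_
  rw [iocLp, norm_indicatorConstLp two_ne_zero (by norm_num), measureReal_restrict_apply
    measurableSet_Ioc, inter_eq_left.mpr (Ioc_subset_U ha hb), Real.volume_real_Ioc_of_le hab,
    Real.sqrt_eq_rpow]
  simp

theorem jumpMeasure_Ioc (p : Finset ℝ) (c : ℝ → ℝ) (h : L2U) {a b : ℝ} (ha : a ∈ U) (hb : b ∈ U)
    (hab : a ≤ b) : jumpMeasure p c h (Ioc a b)
      = ∑ x ∈ p, (Ioc a b).indicator c x + ∫ x in a..b, h x := by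
  rw [jumpMeasure_apply _ _ _ measurableSet_Ioc, setIntegral_Ioc_eq ha hb hab]

/-- A function in `SBV₂(U)` is a primitive of its derivative on intervals without jumps. -/
theorem SBV₂.sub_eq_integral {f : L2U} (d : SBV₂ f) {a b : ℝ} (ha : a ∈ U) (hb : b ∈ U)
    (hab : a ≤ b) (hd : Disjoint (Ioc a b) (d.jumps : Set ℝ)) :
    d.rep b - d.rep a = ∫ x in a..b, d.deriv x := by
  rw [d.measure_eq a ha b hb hab, jumpMeasure_Ioc _ _ _ ha hb hab, Finset.sum_eq_zero, zero_add]
  intro x hx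
  exact indicator_of_notMem (fun h => Set.disjoint_left.mp hd h hx) _

/-! ### Step functions as functions in `SBV₂(U)` with zero derivative -/

theorem exists_pos_forall_lt_abs_sub (p : Finset ℝ) (x : ℝ) :
    ∃ δ > 0, ∀ y ∈ p, y ≠ x → δ < |y - x| := by
  have h : ((p.erase x : Finset ℝ) : Set ℝ)ᶜ ∈ 𝓝 x :=
    (p.erase x).finite_toSet.isClosed.isOpen_compl.mem_nhds (by simp)
  obtain ⟨ε, hε, hb⟩ := Metric.mem_nhds_iff.mp h
  refine ⟨ε / 2, half_pos hε, fun y hy hne => ?_⟩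
  by_contra! hlt
  refine hb (a := y) ?_ (Finset.mem_coe.mpr (Finset.mem_erase.mpr ⟨hne, hy⟩))
  rw [Metric.mem_ball, Real.dist_eq]
  linarith

/-- `t` is constant on every subinterval of `U` that contains no point of `p`. -/
def ConstOff (p : Finset ℝ) (t : ℝ → ℝ) : Prop :=
  ∀ x ∈ U, ∀ y ∈ U, x ≤ y → Disjoint (Icc x y) (p : Set ℝ) → t x = t y

theorem ConstOff.eventually_eq {p : Finset ℝ} {t : ℝ → ℝ} (ht : ConstOff p t) {x : ℝ}
    (hx : x ∈ Ioo (0 : ℝ) 1) (hxp : x ∉ p) : ∀ᶠ y in 𝓝 x, t y = t x := by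
  obtain ⟨δ, hδ, hp⟩ := exists_pos_forall_lt_abs_sub p x
  filter_upwards [Ioo_mem_nhds hx.1 hx.2, Metric.ball_mem_nhds x hδ] with y hy hyb
  rw [Metric.mem_ball, Real.dist_eq] at hyb
  have hfar : ∀ z ∈ p, δ < |z - x| := fun z hz => hp z hz (by rintro rfl; exact hxp hz)
  have hyb' := abs_lt.mp hyb
  rcases le_total x y with h | h
  · refine (ht x ⟨hx.1.le, hx.2.le⟩ y ⟨hy.1.le, hy.2.le⟩ h ?_).symm
    refine Set.disjoint_left.mpr fun z hz hzp => absurd (hfar z hzp) (not_lt.mpr ?_)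
    rw [abs_le]
    constructor <;> linarith [hz.1, hz.2]
  · refine ht y ⟨hy.1.le, hy.2.le⟩ x ⟨hx.1.le, hx.2.le⟩ h ?_
    refine Set.disjoint_left.mpr fun z hz hzp => absurd (hfar z hzp) (not_lt.mpr ?_)
    rw [abs_le]
    constructor <;> linarith [hz.1, hz.2]

theorem ConstOff.jumps_subset {p : Finset ℝ} {t : ℝ → ℝ} (ht : ConstOff p t) :
    {x ∈ Ioo (0 : ℝ) 1 | ¬ ContinuousAt t x} ⊆ p := by
  rintro x ⟨hx, hc⟩
  by_contra hxp
  refine hc (continuousAt_const.congr (f := fun _ => t x) ?_)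
  filter_upwards [ht.eventually_eq hx hxp] with y hy
  exact hy.symm

theorem ConstOff.numJumps_le {p : Finset ℝ} {t : ℝ → ℝ} (ht : ConstOff p t) :
    numJumps t ≤ p.card := by
  rw [← Set.ncard_coe_finset]
  exact Set.ncard_le_ncard ht.jumps_subset p.finite_toSet

theorem ConstOff.exists_left_limit {p : Finset ℝ} {t : ℝ → ℝ} (ht : ConstOff p t) {x : ℝ}
    (hx : x ∈ Ioc (0 : ℝ) 1) : ∃ l, Tendsto t (𝓝[<] x) (𝓝 l) := by
  obtain ⟨δ, hδ, hp⟩ := exists_pos_forall_lt_abs_sub p x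
  have hm : max (x - δ) 0 < x := max_lt (by linarith) hx.1
  obtain ⟨z, hz1, hz2⟩ := exists_between hm
  refine ⟨t z, tendsto_const_nhds.congr' ?_⟩
  have h1 := (le_max_left _ _).trans_lt hz1
  have h2 := (le_max_right _ _).trans_lt hz1
  filter_upwards [Ioo_mem_nhdsLT hz2] with y hy
  refine ht z ⟨h2.le, hz2.le.trans hx.2⟩ y ⟨h2.le.trans hy.1.le, hy.2.le.trans hx.2⟩ hy.1.le ?_
  refine Set.disjoint_left.mpr fun w hw hwp => absurd (hp w hwp ?_) (not_lt.mpr ?_)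
  · exact (hw.2.trans_lt hy.2).ne
  · rw [abs_le]
    constructor <;> linarith [hw.1, hw.2, hy.2]

/-- The increments of a step function are the sums of the heights of the jumps in between. The
step function minus the sum of its jumps is continuous, with zero derivative off a finite set. -/
theorem IsStep.exists_sub_eq_sum {t : ℝ → ℝ} (ht : IsStep t) :
    ∃ (J : Finset ℝ) (c : ℝ → ℝ), (J : Set ℝ) ⊆ Ioo 0 1 ∧ (∀ x ∈ J, c x ≠ 0) ∧
      J.card ≤ numJumps t ∧
      ∀ a ∈ U, ∀ b ∈ U, a ≤ b → t b - t a = ∑ x ∈ J, (Ioc a b).indicator c x := by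
  classical
  obtain ⟨p, hp⟩ := ht.piecewise
  have hp : ConstOff p t := hp
  have hex : ∀ x : ℝ, ∃ l, x ∈ Ioc (0 : ℝ) 1 → Tendsto t (𝓝[<] x) (𝓝 l) := by
    intro x
    by_cases hx : x ∈ Ioc (0 : ℝ) 1
    · obtain ⟨l, hl⟩ := hp.exists_left_limit hx
      exact ⟨l, fun _ => hl⟩
    · exact ⟨0, fun h => absurd h hx⟩
  choose l hl using hex
  have hcont : ∀ x ∈ Ioo (0 : ℝ) 1, ContinuousAt t x → t x - l x = 0 := by
    intro x hx hc
    exact sub_eq_zero.mpr (tendsto_nhds_unique (hc.mono_left nhdsWithin_le_nhds)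
      (hl x ⟨hx.1, hx.2.le⟩))
  set c : ℝ → ℝ := fun x => t x - l x with hc
  set J : Finset ℝ := p.filter (fun x => x ∈ Ioo (0 : ℝ) 1 ∧ c x ≠ 0) with hJ
  have hJdisc : (J : Set ℝ) ⊆ {x ∈ Ioo (0 : ℝ) 1 | ¬ ContinuousAt t x} := by
    intro x hx
    obtain ⟨_, h1, h2⟩ := Finset.mem_filter.mp (Finset.mem_coe.mp hx)
    exact ⟨h1, fun h => h2 (hcont x h1 h)⟩
  refine ⟨J, c, fun x hx => (hJdisc hx).1, fun x hx => (Finset.mem_filter.mp hx).2.2, ?_, ?_⟩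
  · rw [← Set.ncard_coe_finset]
    exact Set.ncard_le_ncard hJdisc (p.finite_toSet.subset hp.jumps_subset)
  -- the sum of the jumps at points `≤ x`
  set S : ℝ → ℝ := fun x => ∑ y ∈ J, if y ≤ x then c y else 0 with hS
  have hSright : ∀ x, ∀ᶠ z in 𝓝[≥] x, S z = S x := by
    intro x
    have : ∀ y ∈ J, ∀ᶠ z in 𝓝[≥] x, (if y ≤ z then c y else 0) = if y ≤ x then c y else 0 := by
      intro y _
      rcases le_or_gt y x with h | h
      · filter_upwards [self_mem_nhdsWithin] with z hz
        rw [if_pos h, if_pos (h.trans hz)]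
      · filter_upwards [mem_nhdsWithin_of_mem_nhds (Iio_mem_nhds h)] with z hz
        rw [if_neg (not_le.mpr h), if_neg (not_le.mpr hz)]
    filter_upwards [(Filter.eventually_all_finset J).mpr this] with z hz
    exact Finset.sum_congr rfl hz
  have hSleft : ∀ x, ∀ᶠ z in 𝓝[<] x, S z = S x - if x ∈ J then c x else 0 := by
    intro x
    have : ∀ y ∈ J, ∀ᶠ z in 𝓝[<] x, (if y ≤ z then c y else 0)
        = (if y ≤ x then c y else 0) - if x = y then c y else 0 := by
      intro y _
      rcases lt_trichotomy y x with h | rfl | h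
      · filter_upwards [mem_nhdsWithin_of_mem_nhds (Ioi_mem_nhds h)] with z hz
        rw [if_pos h.le, if_pos (le_of_lt hz), if_neg h.ne', sub_zero]
      · filter_upwards [self_mem_nhdsWithin] with z hz
        rw [if_neg (not_le.mpr hz), if_pos le_rfl, if_pos rfl, sub_self]
      · filter_upwards [self_mem_nhdsWithin] with z hz
        rw [if_neg (not_le.mpr h), if_neg (not_le.mpr (lt_trans hz h)), if_neg h.ne, sub_zero]
    filter_upwards [(Filter.eventually_all_finset J).mpr this] with z hz
    simp only [hS]
    rw [Finset.sum_congr rfl hz, Finset.sum_sub_distrib, Finset.sum_ite_eq]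
  set D : ℝ → ℝ := fun x => t x - S x with hD
  have hDright : ∀ x ∈ U, ContinuousWithinAt D (Icc x 1) x := by
    intro x hx
    rcases lt_or_eq_of_le hx.2 with h1 | rfl
    · refine (ht.right_cont x ⟨hx.1, h1⟩).sub (Tendsto.congr' ?_ tendsto_const_nhds)
      filter_upwards [nhdsWithin_mono x Icc_subset_Ici_self (hSright x)] with z hz
      exact hz.symm
    · rw [Icc_self]
      exact continuousWithinAt_singleton
  have hDleft : ∀ x ∈ U, ContinuousWithinAt D (Ico 0 x) x := by
    intro x hx
    rcases lt_or_eq_of_le hx.1 with h0 | rfl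
    · have hx' : x ∈ Ioc (0 : ℝ) 1 := ⟨h0, hx.2⟩
      have hlim : Tendsto D (𝓝[<] x) (𝓝 (l x - (S x - if x ∈ J then c x else 0))) := by
        refine (hl x hx').sub (Tendsto.congr' ?_ tendsto_const_nhds)
        filter_upwards [hSleft x] with z hz
        exact hz.symm
      have hval : l x - (S x - if x ∈ J then c x else 0) = D x := by
        have hne : (if x ∈ J then c x else 0) = t x - l x := by
          split_ifs with hxJ
          · rfl
          · rcases lt_or_eq_of_le hx.2 with h1 | rfl
            · by_cases hxp : x ∈ p
              · by_contra hcx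
                exact hxJ (Finset.mem_filter.mpr ⟨hxp, ⟨h0, h1⟩, Ne.symm hcx⟩)
              · by_contra hcx
                exact hxp (hp.jumps_subset ⟨⟨h0, h1⟩, fun h => hcx (hcont x ⟨h0, h1⟩ h).symm⟩)
            · have h2 : Tendsto t (𝓝[<] 1) (𝓝 (t 1)) := by
                rw [← nhdsWithin_Ioo_eq_nhdsLT (zero_lt_one (α := ℝ))]
                exact ht.cont_one.mono_left (nhdsWithin_mono _ Ioo_subset_Icc_self)
              rw [tendsto_nhds_unique h2 (hl 1 hx'), sub_self]
        rw [hne]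
        simp only [hD]
        ring
      rw [hval] at hlim
      exact hlim.mono_left (nhdsWithin_mono _ Ico_subset_Iio_self)
    · rw [Ico_self]
      simp [ContinuousWithinAt]
  have hDcont : ContinuousOn D U := by
    intro x hx
    have := (hDleft x hx).union (hDright x hx)
    rwa [Ico_union_Icc_eq_Icc hx.1 hx.2] at this
  intro a ha b hb hab
  have hconst : D b = D a := by
    have hsub : uIcc a b ⊆ U := by
      rw [uIcc_of_le hab]
      exact Icc_subset_Icc ha.1 hb.2
    have := integral_eq_of_hasDerivAt_off_countable D (fun _ => 0) (s := (p : Set ℝ))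
      p.countable_toSet (hDcont.mono hsub) ?_ (by simp)
    · rw [intervalIntegral.integral_zero] at this
      linarith
    · rintro x ⟨hx, hxp⟩
      rw [min_eq_left hab, max_eq_right hab] at hx
      have hx' : x ∈ Ioo (0 : ℝ) 1 := ⟨ha.1.trans_lt hx.1, hx.2.trans_le hb.2⟩
      refine (hasDerivAt_const x (D x)).congr_of_eventuallyEq ?_
      have hxJ : x ∉ J := fun h => hxp (Finset.mem_filter.mp h).1
      have h1 : ∀ᶠ z in 𝓝 x, S z = S x := by
        rw [← nhdsLT_sup_nhdsGE x, eventually_sup]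
        refine ⟨?_, hSright x⟩
        filter_upwards [hSleft x] with z hz
        rw [hz, if_neg hxJ, sub_zero]
      filter_upwards [h1, hp.eventually_eq hx' hxp] with z h2 h3
      simp only [hD]
      rw [h2, h3]
  have hdiff : t b - t a = S b - S a := by
    simp only [hD] at hconst
    linarith
  rw [hdiff, hS, ← Finset.sum_sub_distrib]
  refine Finset.sum_congr rfl fun y _ => ?_
  by_cases h1 : y ≤ a
  · rw [if_pos h1, if_pos (h1.trans hab), sub_self, indicator_of_notMem]
    exact fun h => absurd h.1 (not_lt.mpr h1)
  · by_cases h2 : y ≤ b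
    · rw [if_neg h1, if_pos h2, sub_zero, indicator_of_mem (mem_Ioc.mpr ⟨not_le.mp h1, h2⟩)]
    · rw [if_neg h1, if_neg h2, sub_self, indicator_of_notMem]
      exact fun h => h2 h.2

/-- A step function plus a primitive of an `L²` function is in `SBV₂(U)`. -/
theorem IsStep.exists_sbv {t : ℝ → ℝ} (ht : IsStep t) {f h : L2U}
    (hf : ∀ᵐ x ∂(volume.restrict U), f x = t x + ∫ s in (0 : ℝ)..x, h s) :
    ∃ d : SBV₂ f, d.deriv = h ∧ d.jumps.card ≤ numJumps t := by
  obtain ⟨J, c, hJ, hc, hcard, hsum⟩ := ht.exists_sub_eq_sum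
  refine ⟨⟨fun x => t x + ∫ s in (0 : ℝ)..x, h s, J, c, h, hf, hJ, hc, ?_⟩, rfl, hcard⟩
  intro a ha b hb hab
  rw [jumpMeasure_Ioc _ _ _ ha hb hab, ← hsum a ha b hb hab, ← integral_sub_integral ha hb]
  ring

theorem SBV₂.isStep {f : L2U} (d : SBV₂ f) (hd : d.deriv = 0) :
    IsStep d.rep ∧ numJumps d.rep ≤ d.jumps.card := by
  have hconst : ConstOff d.jumps d.rep := by
    intro x hx y hy hxy hdis
    have h := d.sub_eq_integral hx hy hxy (hdis.mono_left Ioc_subset_Icc_self)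
    rw [hd, ← setIntegral_Ioc_eq hx hy hxy, integral_congr_ae (ae_restrict_of_ae
      (Lp.coeFn_zero ℝ 2 (volume.restrict U)))] at h
    simp only [Pi.zero_apply, integral_zero] at h
    linarith
  exact ⟨⟨d.right_cont, d.cont_one, d.jumps, hconst⟩, hconst.numJumps_le⟩

/-- A function that is almost everywhere constant off a finite set is a step function. -/
theorem exists_isStep_ae_eq {w : ℝ → ℝ} {X : Finset ℝ} {G : Set ℝ}
    (hG : ∀ᵐ x ∂(volume.restrict U), x ∈ G)
    (hw : ∀ x ∈ G, ∀ y ∈ G, x ∈ U → y ∈ U → x ≤ y → Disjoint (Icc x y) (X : Set ℝ) → w x = w y) :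
    ∃ t, IsStep t ∧ (∀ᵐ x ∂(volume.restrict U), w x = t x) ∧ numJumps t ≤ X.card := by
  -- every nonempty open subinterval of `U` contains points of `G`
  have hpt : ∀ a b : ℝ, 0 ≤ a → a < b → b ≤ 1 → ∃ z ∈ G, z ∈ Ioo a b := by
    intro a b ha hab hb
    rw [ae_restrict_iff' measurableSet_Icc, ae_iff] at hG
    by_contra! hne
    have hle : volume (Ioo a b) ≤ 0 := by
      rw [← hG]
      refine measure_mono fun y hy => ?_
      simp only [mem_ofPred_eq, Classical.not_imp]
      exact ⟨⟨ha.trans hy.1.le, hy.2.le.trans hb⟩, fun h => hne y h hy⟩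
    rw [Real.volume_Ioo] at hle
    exact absurd hle (not_le.mpr (ENNReal.ofReal_pos.mpr (sub_pos.mpr hab)))
  -- the point of `G` at which the right limit of `w` at `x < 1`, or the left limit at `1`, is read
  have hex : ∀ x : ℝ, ∃ z, x ∈ U → z ∈ G ∧ z ∈ U ∧
      (x < 1 → x < z ∧ Disjoint (Ioc x z) (X : Set ℝ)) ∧
      (x = 1 → z < 1 ∧ Disjoint (Ico z 1) (X : Set ℝ)) := by
    intro x
    by_cases hx : x ∈ U
    swap
    · exact ⟨0, fun h => absurd h hx⟩
    obtain ⟨δ, hδ, hp⟩ := exists_pos_forall_lt_abs_sub X x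
    rcases lt_or_eq_of_le hx.2 with h1 | rfl
    · obtain ⟨z, hzG, hz⟩ := hpt x (min (x + δ) 1) hx.1 (lt_min (by linarith) h1) (min_le_right _ _)
      have hz1 := hz.2.trans_le (min_le_left _ _)
      have hz2 := hz.2.trans_le (min_le_right _ _)
      refine ⟨z, fun _ => ⟨hzG, ⟨hx.1.trans hz.1.le, hz2.le⟩, fun _ => ⟨hz.1, ?_⟩,
        fun h => absurd h h1.ne⟩⟩
      refine Set.disjoint_left.mpr fun y hy hyX => absurd (hp y hyX hy.1.ne') (not_lt.mpr ?_)
      rw [abs_le]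
      constructor <;> linarith [hy.1, hy.2]
    · obtain ⟨z, hzG, hz⟩ := hpt (max (1 - δ) 0) 1 (le_max_right _ _)
        (max_lt (by linarith) one_pos) le_rfl
      have hz1 := (le_max_left _ _).trans_lt hz.1
      have hz2 := (le_max_right _ _).trans_lt hz.1
      refine ⟨z, fun _ => ⟨hzG, ⟨hz2.le, hz.2.le⟩, fun h => absurd h (lt_irrefl _),
        fun _ => ⟨hz.2, ?_⟩⟩⟩
      refine Set.disjoint_left.mpr fun y hy hyX => absurd (hp y hyX hy.2.ne) (not_lt.mpr ?_)
      rw [abs_le]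
      constructor <;> linarith [hy.1, hy.2]
  choose z hz using hex
  have hright : ∀ x ∈ U, x < 1 → ∀ y ∈ G, y ∈ U → x < y → Disjoint (Ioc x y) (X : Set ℝ) →
      w (z x) = w y := by
    intro x hx hx1 y hyG hyU hxy hdis
    obtain ⟨h1, h2, h3, _⟩ := hz x hx
    obtain ⟨h3, h4⟩ := h3 hx1
    rcases le_total (z x) y with h | h
    · exact hw _ h1 _ hyG h2 hyU h
        (hdis.mono_left (by intro u hu; exact ⟨h3.trans_le hu.1, hu.2⟩))
    · exact (hw _ hyG _ h1 hyU h2 h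
        (h4.mono_left (by intro u hu; exact ⟨hxy.trans_le hu.1, hu.2⟩))).symm
  have hone : ∀ y ∈ G, y ∈ U → y < 1 → Disjoint (Ico y 1) (X : Set ℝ) → w (z 1) = w y := by
    intro y hyG hyU hy1 hdis
    obtain ⟨h1, h2, _, h3⟩ := hz 1 ⟨zero_le_one, le_rfl⟩
    obtain ⟨h3, h4⟩ := h3 rfl
    rcases le_total (z 1) y with h | h
    · exact hw _ h1 _ hyG h2 hyU h
        (h4.mono_left (by intro u hu; exact ⟨hu.1, hu.2.trans_lt hy1⟩))
    · exact (hw _ hyG _ h1 hyU h2 h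
        (hdis.mono_left (by intro u hu; exact ⟨hu.1, hu.2.trans_lt h3⟩))).symm
  -- constancy on half-open intervals, which contains right-continuity and continuity at `1`
  have hIoc : ∀ x ∈ U, ∀ y ∈ U, x ≤ y → y < 1 → Disjoint (Ioc x y) (X : Set ℝ) →
      w (z x) = w (z y) := by
    intro x hx y hy hxy hy1 hdis
    obtain ⟨h1, h2, h3, _⟩ := hz y hy
    obtain ⟨h3, h4⟩ := h3 hy1
    refine hright x hx (hxy.trans_lt hy1) _ h1 h2 (hxy.trans_lt h3) ?_
    rw [← Ioc_union_Ioc_eq_Ioc hxy h3.le]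
    exact hdis.union_left h4
  have hIoo : ∀ x ∈ U, x < 1 → Disjoint (Ioo x 1) (X : Set ℝ) → w (z x) = w (z 1) := by
    intro x hx hx1 hdis
    obtain ⟨y, hyG, hy⟩ := hpt x 1 hx.1 hx1 le_rfl
    have hyU : y ∈ U := ⟨hx.1.trans hy.1.le, hy.2.le⟩
    rw [hright x hx hx1 y hyG hyU hy.1
        (hdis.mono_left (by intro u hu; exact ⟨hu.1, hu.2.trans_lt hy.2⟩)),
      hone y hyG hyU hy.2
        (hdis.mono_left (by intro u hu; exact ⟨hy.1.trans_le hu.1, hu.2⟩))]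
  have hconst : ConstOff X fun x => w (z x) := by
    intro x hx y hy hxy hdis
    rcases lt_or_eq_of_le hy.2 with h1 | rfl
    · exact hIoc x hx y hy hxy h1 (hdis.mono_left Ioc_subset_Icc_self)
    · rcases lt_or_eq_of_le hx.2 with h2 | rfl
      · exact hIoo x hx h2 (hdis.mono_left Ioo_subset_Icc_self)
      · rfl
  refine ⟨fun x => w (z x), ⟨?_, ?_, X, hconst⟩, ?_, hconst.numJumps_le⟩
  · intro x hx
    obtain ⟨δ, hδ, hp⟩ := exists_pos_forall_lt_abs_sub X x
    refine tendsto_const_nhds.congr' ?_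
    filter_upwards [self_mem_nhdsWithin, mem_nhdsWithin_of_mem_nhds (Iio_mem_nhds
      (show x < min (x + δ) 1 from lt_min (by linarith) hx.2))] with y hy hy2
    refine hIoc x ⟨hx.1, hx.2.le⟩ y ⟨hx.1.trans hy.1, hy.2⟩ hy.1
      (lt_of_lt_of_le (mem_Iio.mp hy2) (min_le_right _ _)) ?_
    have := lt_of_lt_of_le (mem_Iio.mp hy2) (min_le_left _ _)
    refine Set.disjoint_left.mpr fun u hu huX => absurd (hp u huX hu.1.ne') (not_lt.mpr ?_)
    rw [abs_le]
    constructor <;> linarith [hu.1, hu.2]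
  · obtain ⟨δ, hδ, hp⟩ := exists_pos_forall_lt_abs_sub X 1
    refine tendsto_const_nhds.congr' ?_
    filter_upwards [self_mem_nhdsWithin, mem_nhdsWithin_of_mem_nhds (Ioi_mem_nhds
      (show 1 - δ < 1 by linarith))] with y hy hy2
    rcases lt_or_eq_of_le hy.2 with h1 | rfl
    · refine (hIoo y hy h1 ?_).symm
      refine Set.disjoint_left.mpr fun u hu huX => absurd (hp u huX hu.2.ne) (not_lt.mpr ?_)
      have : 1 - δ < y := hy2
      rw [abs_le]
      constructor <;> linarith [hu.1, hu.2]
    · rfl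
  · have hX : ∀ᵐ x ∂(volume.restrict U), x ∉ (X : Set ℝ) := by
      refine ae_restrict_of_ae ?_
      rw [ae_iff]
      simpa using X.countable_toSet.measure_zero volume
    have h1 : ∀ᵐ x ∂(volume.restrict U), x ≠ 1 := by
      rw [ae_iff]
      simp
    filter_upwards [hG, ae_restrict_mem measurableSet_Icc, hX, h1] with x hxG hxU hxX hx1
    have hx1' := lt_of_le_of_ne hxU.2 hx1
    obtain ⟨h1, h2, h3, _⟩ := hz x hxU
    obtain ⟨h3, h4⟩ := h3 hx1'
    refine hw x hxG _ h1 hxU h2 h3.le ?_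
    rw [← Ioc_union_left h3.le]
    exact h4.union_left (disjoint_singleton_left.mpr hxX)

/-! ### Compactness along ultrafilters -/

/-- Families in a Hilbert space with convergent norms have weak limits along ultrafilters, and the
norm is weakly lower semicontinuous. -/
theorem exists_tendsto_inner {ι E : Type*} [NormedAddCommGroup E] [InnerProductSpace ℝ E]
    [CompleteSpace E] {𝒰 : Ultrafilter ι} {h : ι → E} {B : ℝ}
    (hB : Tendsto (fun k => ‖h k‖) 𝒰 (𝓝 B)) :
    ∃ h' : E, ‖h'‖ ≤ B ∧ ∀ g, Tendsto (fun k => inner ℝ g (h k)) 𝒰 (𝓝 (inner ℝ g h')) := by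
  let φ : ι → WeakDual ℝ E :=
    fun k => StrongDual.toWeakDual (InnerProductSpace.toDual ℝ E (h k))
  obtain ⟨x, hx, hle⟩ := (WeakDual.isCompact_closedBall (𝕜 := ℝ) (E := E) 0
    (B + 1)).ultrafilter_le_nhds (𝒰.map φ) (by
      rw [le_principal_iff, Ultrafilter.mem_coe, Ultrafilter.mem_map]
      filter_upwards [hB.eventually (gt_mem_nhds (lt_add_one B))] with k hk
      simpa [φ] using hk.le)
  set h' : E := (InnerProductSpace.toDual ℝ E).symm (WeakDual.toStrongDual x)
  have hweak : ∀ g, Tendsto (fun k => inner ℝ g (h k)) 𝒰 (𝓝 (inner ℝ g h')) := by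
    intro g
    have h1 : Tendsto (fun k => φ k g) 𝒰 (𝓝 (x g)) :=
      ((WeakDual.eval_continuous g).tendsto x).comp hle
    have h2 : inner ℝ g h' = x g := by
      rw [real_inner_comm, InnerProductSpace.toDual_symm_apply]
      rfl
    rw [h2]
    refine h1.congr fun k => ?_
    rw [real_inner_comm]
    rfl
  refine ⟨h', ?_, hweak⟩
  have hle : inner ℝ h' h' ≤ ‖h'‖ * B :=
    le_of_tendsto_of_tendsto' (hweak h') (hB.const_mul ‖h'‖) fun k => real_inner_le_norm _ _
  rw [real_inner_self_eq_norm_sq, sq] at hle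
  rcases (norm_nonneg h').eq_or_lt with h0 | h0
  · rw [← h0]
    exact ge_of_tendsto' hB fun k => norm_nonneg _
  · exact le_of_mul_le_mul_left hle h0

/-- Along an ultrafilter, finite subsets of `U` with at most `N` points converge to such a set. -/
theorem exists_limit_finset {ι : Type*} {𝒰 : Ultrafilter ι} {J : ι → Finset ℝ} {N : ℕ}
    (hJ : ∀ᶠ k in 𝒰, (J k : Set ℝ) ⊆ U) (hN : ∀ᶠ k in 𝒰, (J k).card ≤ N) :
    ∃ X : Finset ℝ, X.card ≤ N ∧ ∀ K : Set ℝ, IsClosed K → Disjoint K (X : Set ℝ) →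
      ∀ᶠ k in 𝒰, Disjoint K (J k : Set ℝ) := by
  classical
  let p : ι → ℕ → ℝ := fun k i => (J k).toList.getD i 0
  have hlim : ∀ i, ∃ x, Tendsto (fun k => p k i) 𝒰 (𝓝 x) := by
    intro i
    obtain ⟨x, _, hx⟩ := (isCompact_Icc (a := (0 : ℝ)) (b := 1)).ultrafilter_le_nhds
      (𝒰.map fun k => p k i) (by
        rw [le_principal_iff, Ultrafilter.mem_coe, Ultrafilter.mem_map]
        filter_upwards [hJ] with k hk
        change (J k).toList.getD i 0 ∈ U
        by_cases hi : i < (J k).toList.length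
        · rw [List.getD_eq_getElem _ _ hi]
          exact hk (Finset.mem_toList.mp (List.getElem_mem hi))
        · rw [List.getD_eq_default _ _ (not_lt.mp hi)]
          exact ⟨le_rfl, zero_le_one⟩)
    exact ⟨x, hx⟩
  choose x hx using hlim
  refine ⟨(Finset.range N).image x, Finset.card_image_le.trans (Finset.card_range N).le,
    fun K hK hdis => ?_⟩
  have hev : ∀ i ∈ Finset.range N, ∀ᶠ k in 𝒰, p k i ∉ K := by
    intro i hi
    refine (hx i).eventually (hK.isOpen_compl.mem_nhds fun hmem => ?_)
    exact Set.disjoint_left.mp hdis hmem (Finset.mem_coe.mpr (Finset.mem_image_of_mem x hi))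
  filter_upwards [hN, (Filter.eventually_all_finset _).mpr hev] with k hk hp
  refine Set.disjoint_right.mpr fun y hy => ?_
  obtain ⟨i, hi, rfl⟩ := List.getElem_of_mem (Finset.mem_toList.mpr (Finset.mem_coe.mp hy))
  have := hp i (Finset.mem_range.mpr ((hi.trans_eq (Finset.length_toList _)).trans_le hk))
  rwa [show p k i = (J k).toList[i] from List.getD_eq_getElem _ _ hi] at this

/-- Closedness of `SBV₂(U)` with bounds on the number of jumps and on the derivative. The
approximating functions only need to be primitives of the `h k` off the sets `J k` up to a vanishing
error, which covers step functions on grids. -/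
theorem exists_sbv_of_tendsto {ι : Type*} {𝒰 : Ultrafilter ι} {f : L2U} {r : ι → ℝ → ℝ}
    {J : ι → Finset ℝ} {h : ι → L2U} {e : ι → ℝ} {N : ℕ} {B : ℝ}
    (hJ : ∀ᶠ k in 𝒰, (J k : Set ℝ) ⊆ U) (hN : ∀ᶠ k in 𝒰, (J k).card ≤ N)
    (hB : Tendsto (fun k => ‖h k‖) 𝒰 (𝓝 B)) (he : Tendsto e 𝒰 (𝓝 0))
    (hr : ∀ᶠ k in 𝒰, ∀ x ∈ U, ∀ y ∈ U, x ≤ y → Disjoint (Icc x y) (J k : Set ℝ) →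
      |r k y - r k x - ∫ s in x..y, h k s| ≤ e k)
    (hf : ∀ᵐ x ∂(volume.restrict U), Tendsto (fun k => r k x) 𝒰 (𝓝 (f x))) :
    ∃ d : SBV₂ f, d.jumps.card ≤ N ∧ ‖d.deriv‖ ≤ B := by
  obtain ⟨h', hh', hweak⟩ := exists_tendsto_inner hB
  obtain ⟨X, hX, hXJ⟩ := exists_limit_finset hJ hN
  obtain ⟨t, ht, hwt, htX⟩ := exists_isStep_ae_eq (w := fun x => f x - ∫ s in (0 : ℝ)..x, h' s)
    (X := X) (G := {x | Tendsto (fun k => r k x) 𝒰 (𝓝 (f x))}) hf (by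
      intro x hxG y hyG hx hy hxy hdis
      have h1 : Tendsto (fun k => r k y - r k x - ∫ s in x..y, h k s) 𝒰
          (𝓝 (f y - f x - ∫ s in x..y, h' s)) := by
        refine (Tendsto.sub hyG hxG).sub ?_
        simpa only [inner_iocLp hx hy hxy] using hweak (iocLp x y)
      have h2 : Tendsto (fun k => r k y - r k x - ∫ s in x..y, h k s) 𝒰 (𝓝 0) := by
        refine squeeze_zero_norm' ?_ he
        filter_upwards [hr, hXJ _ isClosed_Icc hdis] with k hk hk'
        exact hk x hx y hy hxy hk'
      have h3 := tendsto_nhds_unique h1 h2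
      rw [← integral_sub_integral hx hy] at h3
      linarith)
  obtain ⟨d, hd, hcard⟩ := ht.exists_sbv (f := f) (h := h') (by
    filter_upwards [hwt] with x hx
    linarith)
  exact ⟨d, hcard.trans (htX.trans hX), hd ▸ hh'⟩

/-- Below every frequently occurring event there is an ultrafilter along which a convergent sequence
in `L²(U)` also converges almost everywhere. -/
theorem exists_ultrafilter_tendsto_ae {u : ℕ → L2U} {f : L2U} (hu : Tendsto u atTop (𝓝 f))
    {P : ℕ → Prop} (hP : ∃ᶠ s in atTop, P s) :
    ∃ 𝒰 : Ultrafilter ℕ, (𝒰 : Filter ℕ) ≤ atTop ∧ (∀ᶠ s in 𝒰, P s) ∧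
      ∀ᵐ x ∂(volume.restrict U), Tendsto (fun s => u s x) 𝒰 (𝓝 (f x)) := by
  obtain ⟨φ, hφ, hPφ⟩ := extraction_of_frequently_atTop hP
  obtain ⟨ψ, hψ, hae⟩ := (tendstoInMeasure_of_tendsto_Lp
    (hu.comp hφ.tendsto_atTop)).exists_seq_tendsto_ae
  have hle : ((hyperfilter ℕ : Ultrafilter ℕ) : Filter ℕ) ≤ atTop := by
    rw [← Nat.cofinite_eq_atTop]
    exact hyperfilter_le_cofinite
  refine ⟨(hyperfilter ℕ).map (φ ∘ ψ), ?_, ?_, ?_⟩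
  · exact (hφ.comp hψ).tendsto_atTop.mono_left hle
  · exact (Ultrafilter.mem_map (m := φ ∘ ψ)).mpr (Eventually.of_forall fun k => hPφ (ψ k))
  · filter_upwards [hae] with x hx
    exact hx.mono_left hle

/-! ### A uniform description of the family of functionals -/

/-- The energy of one bond with increment `δ` on the grid with `n` points: the truncated parabola of
the Blake–Zisserman functional, with its limit `γ · 1_{δ ≠ 0}` at `μ = 0`. It vanishes for `γ = 0`,
so that it serves all discrete functionals of the family. -/
noncomputable def bondEnergy (n : ℕ) (γ μ δ : ℝ) : ℝ :=
  if μ = 0 then (if δ = 0 then 0 else γ) else min (n / μ ^ 2 * δ ^ 2) γ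

/-- The sum of the bond energies of `f` on the grid with `n` points. -/
noncomputable def gridEnergy (n : ℕ) (γ μ : ℝ) (f : L2U) : ℝ :=
  ∑ κ ∈ Finset.range (n - 1), bondEnergy n γ μ (sample n f (κ + 1) - sample n f κ)

open Classical in
/-- The signal that the functionals with sampling parameter `t` compare with: `g` for `t = 0`, its
cell means for `t = 1/n`. -/
noncomputable def sampledSignal (g : L2U) (t : ℝ) : L2U :=
  if t = 0 then g else stepLp (sampleSize t) (sample (sampleSize t) g)

theorem bondEnergy_nonneg (n : ℕ) {γ : ℝ} (hγ : 0 ≤ γ) (μ δ : ℝ) : 0 ≤ bondEnergy n γ μ δ := by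
  unfold bondEnergy
  split_ifs
  · exact le_rfl
  · exact hγ
  · exact le_min (by positivity) hγ

theorem bondEnergy_le (n : ℕ) {γ : ℝ} (hγ : 0 ≤ γ) (μ δ : ℝ) : bondEnergy n γ μ δ ≤ γ := by
  unfold bondEnergy
  split_ifs
  · exact hγ
  · exact le_rfl
  · exact min_le_right _ _

theorem bondEnergy_le_quadratic (n : ℕ) (γ : ℝ) {μ δ : ℝ} (h : μ = 0 → δ = 0) :
    bondEnergy n γ μ δ ≤ n / μ ^ 2 * δ ^ 2 := by
  unfold bondEnergy
  split_ifs with h1 h2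
  · positivity
  · exact absurd (h h1) h2
  · exact min_le_left _ _

theorem bondEnergy_eq_or (n : ℕ) (γ μ δ : ℝ) : bondEnergy n γ μ δ = γ ∨
    (bondEnergy n γ μ δ = n / μ ^ 2 * δ ^ 2 ∧ (μ = 0 → δ = 0)) := by
  unfold bondEnergy
  split_ifs with h1 h2
  · right
    simp [h1, h2]
  · exact Or.inl rfl
  · rcases min_choice (n / μ ^ 2 * δ ^ 2) γ with h | h
    · exact Or.inr ⟨h, fun h' => absurd h' h1⟩
    · exact Or.inl h

theorem bondEnergy_zero_left (n : ℕ) (μ δ : ℝ) : bondEnergy n 0 μ δ = 0 :=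
  le_antisymm (bondEnergy_le n le_rfl μ δ) (bondEnergy_nonneg n le_rfl μ δ)

theorem gridEnergy_nonneg (n : ℕ) {γ : ℝ} (hγ : 0 ≤ γ) (μ : ℝ) (f : L2U) :
    0 ≤ gridEnergy n γ μ f :=
  Finset.sum_nonneg fun _ _ => bondEnergy_nonneg n hγ μ _

theorem Cube.param_cases (q : Cube) :
    q.1.2.2 = 0 ∨ ∃ n : ℕ, 1 ≤ n ∧ q.1.2.2 = 1 / n := q.2.2.2

theorem sampledSignal_zero (g : L2U) : sampledSignal g 0 = g := if_pos rfl

theorem sampledSignal_one_div (g : L2U) {n : ℕ} (hn : 1 ≤ n) :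
    sampledSignal g (1 / n) = stepLp n (sample n g) := by
  have hn' : (n : ℝ) ≠ 0 := by exact_mod_cast (show n ≠ 0 by omega)
  rw [sampledSignal, if_neg (one_div_ne_zero hn'), sampleSize_one_div]

theorem F_of_isDiscrete (g : L2U) {q : Cube} {n : ℕ} (hn : 1 ≤ n) (hq : q.1.2.2 = 1 / n) {f : L2U}
    (hf : IsDiscrete n f) : F g q f
      = ((gridEnergy n q.1.1 q.1.2.1 f + ‖f - sampledSignal g q.1.2.2‖ ^ 2 : ℝ) : EReal) := by
  have hn' : (0 : ℝ) < 1 / n := by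
    have : (0 : ℝ) < n := by exact_mod_cast hn
    positivity
  have hγ := q.2.1
  have hμ := q.2.2.1
  rw [hq, sampledSignal_one_div g hn, ← hf.fidelity_eq g]
  simp only [F, hq, if_pos hn', sampleSize_one_div]
  split_ifs with h1 h2
  · rw [blakeZisserman, if_pos hf]
    simp only [gridEnergy, bondEnergy, if_neg h2.ne']
  · rw [discretePotts, if_pos hf]
    have h2' : q.1.2.1 = 0 := le_antisymm (not_lt.mp h2) hμ
    simp only [gridEnergy, bondEnergy, if_pos h2', Finset.card_filter, sub_eq_zero, ne_eq]
    push_cast [Finset.mul_sum]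
    simp only [mul_ite, mul_one, mul_zero, ite_not]
  · have h1' : q.1.1 = 0 := le_antisymm (not_lt.mp h1) hγ
    rw [discreteDistance, if_pos hf, h1']
    simp only [gridEnergy, bondEnergy_zero_left, Finset.sum_const_zero, zero_add]

theorem F_of_not_isDiscrete (g : L2U) {q : Cube} {n : ℕ} (hn : 1 ≤ n) (hq : q.1.2.2 = 1 / n)
    {f : L2U} (hf : ¬ IsDiscrete n f) : F g q f = ⊤ := by
  have hn' : (0 : ℝ) < 1 / n := by
    have : (0 : ℝ) < n := by exact_mod_cast hn
    positivity
  simp only [F, hq, if_pos hn', sampleSize_one_div]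
  split_ifs
  · rw [blakeZisserman, if_neg hf]
  · rw [discretePotts, if_neg hf]
  · rw [discreteDistance, if_neg hf]

theorem F_eq_distance (g : L2U) {q : Cube} (hγ : q.1.1 = 0) (ht : q.1.2.2 = 0) (f : L2U) :
    F g q f = ((‖f - g‖ ^ 2 : ℝ) : EReal) := by
  simp [F, hγ, ht, distance]

theorem integral_zero_Lp (a b : ℝ) (ha : a ∈ U) (hb : b ∈ U) (hab : a ≤ b) :
    ∫ s in a..b, (0 : L2U) s = 0 := by
  rw [← inner_iocLp ha hb hab, inner_zero_right]

/-- For `t = 0` and `γ > 0` the functional is attained by an `SBV₂` witness: the Potts functional is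
the Mumford–Shah functional under the constraint `f' = 0`. -/
theorem exists_sbv_of_F_le {g : L2U} {q : Cube} (hγ : 0 < q.1.1) (ht : q.1.2.2 = 0) {f : L2U}
    {c : ℝ} (hc : F g q f ≤ c) : ∃ d : SBV₂ f, (q.1.2.1 = 0 → d.deriv = 0) ∧
      q.1.1 * d.jumps.card + 1 / q.1.2.1 ^ 2 * ‖d.deriv‖ ^ 2 + ‖f - g‖ ^ 2 ≤ c := by
  have hμ := q.2.2.1
  simp only [F, ht, if_pos hγ, lt_irrefl, if_false] at hc
  split_ifs at hc with h2
  · rw [mumfordShah] at hc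
    split_ifs at hc with h
    · refine ⟨h.some, fun h0 => absurd h0 h2.ne', ?_⟩
      rw [norm_sq_eq_integral h.some.deriv]
      exact_mod_cast hc
    · exact absurd hc (not_le.mpr (EReal.coe_lt_top c))
  · rw [potts] at hc
    split_ifs at hc with h
    · obtain ⟨hs, hae⟩ := h.choose_spec
      obtain ⟨d, hd, hcard⟩ := hs.exists_sbv (f := f) (h := 0) (by
        filter_upwards [hae, ae_restrict_mem measurableSet_Icc] with x hx hxU
        rw [integral_zero_Lp 0 x ⟨le_rfl, zero_le_one⟩ hxU hxU.1, add_zero, hx])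
      refine ⟨d, fun _ => hd, ?_⟩
      rw [hd, norm_zero, zero_pow two_ne_zero, mul_zero, add_zero]
      refine le_trans ?_ (EReal.coe_le_coe_iff.mp hc)
      gcongr
    · exact absurd hc (not_le.mpr (EReal.coe_lt_top c))

theorem F_le_of_sbv {g : L2U} {q : Cube} (ht : q.1.2.2 = 0) {f : L2U} (d : SBV₂ f)
    (hd : q.1.2.1 = 0 → d.deriv = 0) : F g q f
      ≤ ((q.1.1 * d.jumps.card + 1 / q.1.2.1 ^ 2 * ‖d.deriv‖ ^ 2 + ‖f - g‖ ^ 2 : ℝ) : EReal) := by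
  have hγ := q.2.1
  have hμ := q.2.2.1
  simp only [F, ht, lt_irrefl, if_false]
  split_ifs with h1 h2
  · have h : Nonempty (SBV₂ f) := ⟨d⟩
    rw [mumfordShah, dif_pos h, (h.some.unique d).1, (h.some.unique d).2,
      norm_sq_eq_integral d.deriv]
  · obtain ⟨hs, hle⟩ := d.isStep (hd (le_antisymm (not_lt.mp h2) hμ))
    have h : ∃ t : ℝ → ℝ, IsStep t ∧ ∀ᵐ s ∂(volume.restrict U), f s = t s :=
      ⟨d.rep, hs, d.rep_eq⟩
    rw [potts, dif_pos h, EReal.coe_le_coe_iff, h.choose_spec.1.numJumps_eq hs (by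
      filter_upwards [h.choose_spec.2, d.rep_eq] with s e1 e2
      rw [← e1, e2])]
    have : 0 ≤ 1 / q.1.2.1 ^ 2 * ‖d.deriv‖ ^ 2 := by positivity
    have : q.1.1 * numJumps d.rep ≤ q.1.1 * d.jumps.card := by gcongr
    linarith
  · rw [distance, EReal.coe_le_coe_iff]
    have : 0 ≤ 1 / q.1.2.1 ^ 2 * ‖d.deriv‖ ^ 2 := by positivity
    have : 0 ≤ q.1.1 * d.jumps.card := by positivity
    linarith

/-- Every functional of the family dominates its data term. -/
theorem norm_sq_le_of_F_le {g : L2U} {q : Cube} {f : L2U} {c : ℝ} (hc : F g q f ≤ c) :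
    ‖f - sampledSignal g q.1.2.2‖ ^ 2 ≤ c := by
  have hγ := q.2.1
  rcases q.param_cases with ht | ⟨n, hn, ht⟩
  · rw [ht, sampledSignal_zero]
    rcases hγ.eq_or_lt with h0 | h0
    · rw [F_eq_distance g h0.symm ht] at hc
      exact EReal.coe_le_coe_iff.mp hc
    · obtain ⟨d, _, h⟩ := exists_sbv_of_F_le h0 ht hc
      have : 0 ≤ 1 / q.1.2.1 ^ 2 * ‖d.deriv‖ ^ 2 := by positivity
      have : 0 ≤ q.1.1 * d.jumps.card := by positivity
      linarith
  · by_cases hf : IsDiscrete n f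
    · rw [F_of_isDiscrete g hn ht hf, EReal.coe_le_coe_iff] at hc
      linarith [gridEnergy_nonneg n hγ q.1.2.1 f]
    · rw [F_of_not_isDiscrete g hn ht hf] at hc
      exact absurd hc (not_le.mpr (EReal.coe_lt_top c))

/-! ### Step functions on a grid as approximate primitives -/

theorem integral_cell (f : L2U) {n κ : ℕ} (hκ : κ < n) :
    ∫ s in ((κ : ℝ) / n)..((κ + 1 : ℝ) / n), f s = 1 / n * sample n f κ := by
  have hn' : (n : ℝ) ≠ 0 := by exact_mod_cast (show n ≠ 0 by omega)
  rw [sample]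
  field_simp

theorem integral_stepLp_eq_sub {n : ℕ} {v w : ℕ → ℝ} {i j : ℕ} (hij : i ≤ j) (hj : j ≤ n)
    (hw : ∀ κ, i ≤ κ → κ < j → w κ = n * (v (κ + 1) - v κ)) :
    ∫ s in ((i : ℝ) / n)..((j : ℝ) / n), stepLp n w s = v j - v i := by
  induction j, hij using Nat.le_induction with
  | base => simp
  | succ j hij ih =>
    have hn' : (n : ℝ) ≠ 0 := by exact_mod_cast (show n ≠ 0 by omega)
    have h1 := ih (by omega) fun κ h1 h2 => hw κ h1 (by omega)
    have h2 := integral_cell (stepLp n w) (show j < n by omega)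
    rw [sample_stepLp (by omega), hw j hij (by omega)] at h2
    rw [← intervalIntegral.integral_add_adjacent_intervals (b := (j : ℝ) / n)
      (intervalIntegrable_coe (div_mem_U (by omega)) (div_mem_U (by omega)) _)
      (intervalIntegrable_coe (div_mem_U (by omega)) (div_mem_U hj) _), h1]
    push_cast
    rw [h2]
    field_simp
    ring

/-- A grid step function is an approximate primitive of its difference quotient `w` off a set `J` that
contains the right end point of every bond where `w` was altered. The integral of `w` between grid
points is the exact increment, so only the two boundary cells contribute to the error. -/
theorem abs_stepOf_sub_sub_integral_le {n : ℕ} (hn : 1 ≤ n) {v w : ℕ → ℝ} {J : Set ℝ}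
    (hw : ∀ κ, κ + 1 < n → ((κ + 1 : ℝ) / n) ∉ J → w κ = n * (v (κ + 1) - v κ))
    {x y : ℝ} (hx : x ∈ U) (hy : y ∈ U) (hxy : x ≤ y) (hdis : Disjoint (Icc x y) J) :
    |stepOf n v y - stepOf n v x - ∫ s in x..y, stepLp n w s|
      ≤ 2 * ‖stepLp n w‖ * √(1 / n) := by
  have hn' : (0 : ℝ) < n := by exact_mod_cast hn
  have hle : ∀ z ∈ U, |∫ s in ((cellIndex n z : ℝ) / n)..z, stepLp n w s|
      ≤ ‖stepLp n w‖ * √(1 / n) := by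
    intro z hz
    refine (abs_integral_le (div_mem_U (cellIndex_lt hn z).le) hz (cellIndex_div_le hn hz)
      _).trans ?_
    rw [mul_comm]
    gcongr
    have := le_cellIndex_add_one_div hn hz
    rw [add_div] at this
    linarith
  have hint := integral_stepLp_eq_sub (v := v) (w := w) (cellIndex_mono n hxy)
    (cellIndex_lt hn y).le (fun κ h1 h2 => by
      have h3 := cellIndex_lt hn y
      refine hw κ (by omega) (Set.disjoint_left.mp hdis ⟨?_, ?_⟩)
      · refine (le_cellIndex_add_one_div hn hx).trans ?_
        gcongr
      · refine le_trans ?_ (cellIndex_div_le hn hy)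
        gcongr
        exact_mod_cast h2)
  have hiU := div_mem_U (cellIndex_lt hn x).le
  have hjU := div_mem_U (cellIndex_lt hn y).le
  rw [stepOf_apply hn v hy, stepOf_apply hn v hx, ← hint]
  have e1 := integral_sub_integral hiU hjU (stepLp n w)
  have e2 := integral_sub_integral hx hy (stepLp n w)
  have e3 := integral_sub_integral hiU hx (stepLp n w)
  have e4 := integral_sub_integral hjU hy (stepLp n w)
  have a1 := abs_le.mp (hle x hx)
  have a2 := abs_le.mp (hle y hy)
  rw [abs_le]
  constructor <;> linarith

/-- A bound on a functional of the family with `γ > 0` provides a representative that is an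
approximate primitive off a finite set; the cost of that set, the norm of the derivative and the data
term obey the same bound. On a grid the set consists of the bonds that pay the full price `γ`, and the
derivative is the difference quotient on the remaining bonds. For `μ = 0` the junk value `1 / 0 = 0`
removes the derivative term, and the condition `h = 0` replaces it. -/
theorem exists_approx_primitive_of_F_le {g : L2U} {q : Cube} (hγ : 0 < q.1.1) {f : L2U} {c : ℝ}
    (hc : F g q f ≤ c) : ∃ (r : ℝ → ℝ) (J : Finset ℝ) (h : L2U),
      (∀ᵐ x ∂(volume.restrict U), f x = r x) ∧ (J : Set ℝ) ⊆ U ∧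
      (∀ x ∈ U, ∀ y ∈ U, x ≤ y → Disjoint (Icc x y) (J : Set ℝ) →
        |r y - r x - ∫ s in x..y, h s| ≤ 2 * ‖h‖ * √q.1.2.2) ∧
      (q.1.2.1 = 0 → h = 0) ∧
      q.1.1 * J.card + 1 / q.1.2.1 ^ 2 * ‖h‖ ^ 2 + ‖f - sampledSignal g q.1.2.2‖ ^ 2 ≤ c := by
  classical
  rcases q.param_cases with ht | ⟨n, hn, ht⟩
  · obtain ⟨d, hd, hle⟩ := exists_sbv_of_F_le hγ ht hc
    refine ⟨d.rep, d.jumps, d.deriv, d.rep_eq, d.jumps_subset.trans Ioo_subset_Icc_self, ?_, hd, ?_⟩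
    · intro x hx y hy hxy hdis
      rw [d.sub_eq_integral hx hy hxy (hdis.mono_left Ioc_subset_Icc_self), sub_self, abs_zero]
      positivity
    · rwa [ht, sampledSignal_zero]
  by_cases hf : IsDiscrete n f
  swap
  · rw [F_of_not_isDiscrete g hn ht hf] at hc
    exact absurd hc (not_le.mpr (EReal.coe_lt_top c))
  have hn' : (0 : ℝ) < n := by exact_mod_cast hn
  rw [F_of_isDiscrete g hn ht hf, EReal.coe_le_coe_iff] at hc
  set γ := q.1.1
  set μ := q.1.2.1
  set v := sample n f with hv
  let E : ℕ → ℝ := fun κ => bondEnergy n γ μ (v (κ + 1) - v κ)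
  let w : ℕ → ℝ := fun κ => if κ + 1 < n ∧ E κ ≠ γ then n * (v (κ + 1) - v κ) else 0
  let K : Finset ℕ := (Finset.range (n - 1)).filter fun κ => E κ = γ
  let J : Finset ℝ := K.image fun κ : ℕ => (κ + 1 : ℝ) / n
  have hsum : γ * K.card + 1 / μ ^ 2 * ‖stepLp n w‖ ^ 2 = gridEnergy n γ μ f := by
    obtain ⟨m, rfl⟩ : ∃ m, n = m + 1 := ⟨n - 1, by omega⟩
    have hlast : w m = 0 := if_neg fun h => absurd h.1 (by omega)
    rw [norm_stepLp_sq, Finset.sum_range_succ, hlast, gridEnergy, Finset.card_filter]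
    push_cast
    simp only [Finset.mul_sum, ne_eq, OfNat.ofNat_ne_zero, not_false_eq_true, zero_pow, add_zero,
      ← Finset.sum_add_distrib]
    refine Finset.sum_congr rfl fun κ hκ => ?_
    have hκ' : κ + 1 < m + 1 := by
      have := Finset.mem_range.mp hκ
      omega
    by_cases hE : E κ = γ
    · have hw0 : w κ = 0 := if_neg fun h => h.2 hE
      rw [if_pos hE, hw0]
      simpa using hE.symm
    · have hw1 : w κ = (m + 1 : ℕ) * (v (κ + 1) - v κ) := if_pos ⟨hκ', hE⟩
      rw [if_neg hE, hw1, ((bondEnergy_eq_or _ _ _ _).resolve_left hE).1]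
      push_cast at hn' ⊢
      rcases eq_or_ne μ 0 with h0 | h0
      · simp [h0]
      · field_simp
        ring
  refine ⟨stepOf n v, J, stepLp n w, ?_, ?_, ?_, ?_, ?_⟩
  · conv_lhs => rw [← hf.stepLp_sample]
    exact coeFn_stepLp n v
  · intro x hx
    obtain ⟨κ, hκ, rfl⟩ := Finset.mem_image.mp (Finset.mem_coe.mp hx)
    have := Finset.mem_range.mp (Finset.mem_filter.mp hκ).1
    exact_mod_cast div_mem_U (n := n) (k := κ + 1) (by omega)
  · intro x hx y hy hxy hdis
    rw [ht]
    refine abs_stepOf_sub_sub_integral_le hn (fun κ hκ hκJ => if_pos ⟨hκ, fun hE => hκJ ?_⟩) hx hy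
      hxy hdis
    exact Finset.mem_coe.mpr (Finset.mem_image_of_mem _
      (Finset.mem_filter.mpr ⟨Finset.mem_range.mpr (by omega), hE⟩))
  · intro hμ
    have : stepLp n w = stepLp n fun _ => 0 := by
      refine stepLp_congr fun κ _ => ?_
      by_cases h : κ + 1 < n ∧ E κ ≠ γ
      · simp only [w, if_pos h, ((bondEnergy_eq_or _ _ _ _).resolve_left h.2).2 hμ, mul_zero]
      · simp only [w, if_neg h]
    rw [this]
    simp [stepLp]
  · have hcard : γ * J.card ≤ γ * K.card := by
      gcongr
      exact Finset.card_image_le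
    linarith

/-! ### Sampling functions in `SBV₂(U)` -/

theorem norm_stepLp_sample_le (n : ℕ) (f : L2U) : ‖stepLp n (sample n f)‖ ≤ ‖f‖ := by
  have h : ‖stepLp n (sample n f)‖ * ‖stepLp n (sample n f)‖ ≤ ‖stepLp n (sample n f)‖ * ‖f‖ := by
    rw [← sq, ← real_inner_self_eq_norm_sq, inner_stepLp_stepLp, ← inner_stepLp]
    exact real_inner_le_norm _ _
  rcases (norm_nonneg (stepLp n (sample n f))).eq_or_lt with h0 | h0
  · rw [← h0]
    exact norm_nonneg f
  · exact le_of_mul_le_mul_left h h0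

/-- The step function with the values of the representative of `f` at the grid points. -/
noncomputable def SBV₂.gridSample {f : L2U} (d : SBV₂ f) (n : ℕ) : L2U :=
  stepLp n fun κ => d.rep (κ / n)

theorem SBV₂.gridEnergy_le {f : L2U} (d : SBV₂ f) {γ μ : ℝ} (hγ : 0 ≤ γ)
    (hd : μ = 0 → d.deriv = 0) (n : ℕ) :
    gridEnergy n γ μ (d.gridSample n) ≤ γ * d.jumps.card + 1 / μ ^ 2 * ‖d.deriv‖ ^ 2 := by
  classical
  rcases Nat.eq_zero_or_pos n with rfl | hn
  · simp only [gridEnergy, Nat.zero_sub, Finset.range_zero, Finset.sum_empty]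
    positivity
  have hn' : (0 : ℝ) < n := by exact_mod_cast hn
  -- the bonds that are crossed by a jump
  let K : Finset ℕ := d.jumps.image fun x : ℝ => ⌈n * x⌉₊ - 1
  have hbond : ∀ κ ∈ Finset.range (n - 1),
      bondEnergy n γ μ (sample n (d.gridSample n) (κ + 1) - sample n (d.gridSample n) κ)
        ≤ γ * (if κ ∈ K then 1 else 0) + 1 / μ ^ 2 * (1 / n * sample n d.deriv κ ^ 2) := by
    intro κ hκ
    have hκ' := Finset.mem_range.mp hκ
    have hpos : 0 ≤ 1 / μ ^ 2 * (1 / n * sample n d.deriv κ ^ 2) := by positivity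
    by_cases hK : κ ∈ K
    · rw [if_pos hK, mul_one]
      linarith [bondEnergy_le n hγ μ
        (sample n (d.gridSample n) (κ + 1) - sample n (d.gridSample n) κ)]
    · have hdis : Disjoint (Ioc ((κ : ℝ) / n) ((κ + 1 : ℝ) / n)) (d.jumps : Set ℝ) := by
        refine Set.disjoint_left.mpr fun x hx hxJ => hK ?_
        refine Finset.mem_image.mpr ⟨x, hxJ, ?_⟩
        have h1 := hx.1
        have h2 := hx.2
        rw [div_lt_iff₀ hn'] at h1
        rw [le_div_iff₀ hn'] at h2
        have : ⌈n * x⌉₊ = κ + 1 := by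
          rw [Nat.ceil_eq_iff (by omega)]
          push_cast
          constructor <;> linarith
        omega
      have hU2 := div_mem_U (n := n) (k := κ + 1) (by omega)
      push_cast at hU2
      have hδ : sample n (d.gridSample n) (κ + 1) - sample n (d.gridSample n) κ
          = 1 / n * sample n d.deriv κ := by
        rw [gridSample, sample_stepLp (by omega), sample_stepLp (by omega),
          ← integral_cell d.deriv (by omega)]
        push_cast
        exact d.sub_eq_integral (div_mem_U (by omega)) hU2 (div_le_add_one_div n κ) hdis
      have hδ0 : μ = 0 → 1 / n * sample n d.deriv κ = 0 := by
        intro h0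
        rw [← integral_cell d.deriv (by omega), hd h0]
        exact integral_zero_Lp _ _ (div_mem_U (by omega)) hU2 (div_le_add_one_div n κ)
      rw [hδ, if_neg hK]
      refine (bondEnergy_le_quadratic n γ hδ0).trans_eq ?_
      rcases eq_or_ne μ 0 with h0 | h0
      · simp [h0]
      · field_simp
        ring
  refine (Finset.sum_le_sum hbond).trans ?_
  rw [Finset.sum_add_distrib, ← Finset.mul_sum, ← Finset.mul_sum, ← Finset.mul_sum]
  gcongr ?_ * ?_ + ?_ * ?_
  · rw [Finset.sum_ite_mem]
    simp only [Finset.sum_const, nsmul_eq_mul, mul_one]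
    exact_mod_cast (Finset.card_le_card Finset.inter_subset_right).trans Finset.card_image_le
  · have h1 : ‖stepLp n (sample n d.deriv)‖ ^ 2 ≤ ‖d.deriv‖ ^ 2 := by
      gcongr
      exact norm_stepLp_sample_le n d.deriv
    refine le_trans ?_ h1
    rw [norm_stepLp_sq]
    gcongr
    omega

theorem SBV₂.tendsto_gridSample {f : L2U} (d : SBV₂ f) :
    Tendsto d.gridSample atTop (𝓝 f) := by
  have h0 : (0 : ℝ) ∈ U := ⟨le_rfl, zero_le_one⟩
  refine tendsto_stepLp_of_continuousAt (M := |d.rep 0| + (∑ x ∈ d.jumps, |d.height x| + ‖d.deriv‖))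
    d.rep_eq (fun x hx => ?_) ?_
  · have h1 := d.measure_eq 0 h0 x hx hx.1
    rw [jumpMeasure_Ioc _ _ _ h0 hx hx.1] at h1
    have h2 : |∑ y ∈ d.jumps, (Ioc 0 x).indicator d.height y| ≤ ∑ y ∈ d.jumps, |d.height y| := by
      refine (Finset.abs_sum_le_sum_abs _ _).trans (Finset.sum_le_sum fun y _ => ?_)
      by_cases hy : y ∈ Ioc 0 x
      · rw [indicator_of_mem hy]
      · rw [indicator_of_notMem hy, abs_zero]
        exact abs_nonneg _
    have h3 : |∫ s in (0 : ℝ)..x, d.deriv s| ≤ ‖d.deriv‖ := by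
      refine (abs_integral_le h0 hx hx.1 d.deriv).trans ?_
      refine mul_le_of_le_one_left (norm_nonneg _) ?_
      rw [Real.sqrt_le_one, sub_zero]
      exact hx.2
    have h4 : d.rep x = d.rep 0 + (∑ y ∈ d.jumps, (Ioc 0 x).indicator d.height y
        + ∫ s in (0 : ℝ)..x, d.deriv s) := by linarith
    rw [h4]
    exact (abs_add_le _ _).trans (add_le_add le_rfl ((abs_add_le _ _).trans (add_le_add h2 h3)))
  · have hJ : ∀ᵐ x ∂(volume.restrict U), x ∉ (d.jumps : Set ℝ) := by
      refine ae_restrict_of_ae ?_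
      rw [ae_iff]
      simpa using d.jumps.countable_toSet.measure_zero volume
    filter_upwards [hJ, ae_restrict_mem measurableSet_Icc] with x hxJ hxU
    obtain ⟨δ, hδ, hp⟩ := exists_pos_forall_lt_abs_sub d.jumps x
    have hfar : ∀ z ∈ d.jumps, δ < |z - x| := fun z hz => hp z hz (by rintro rfl; exact hxJ hz)
    rw [ContinuousWithinAt, tendsto_iff_norm_sub_tendsto_zero]
    have hlim : Tendsto (fun y => √|y - x| * ‖d.deriv‖) (𝓝[U] x) (𝓝 0) := by
      have : Continuous fun y => √|y - x| * ‖d.deriv‖ := by fun_prop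
      simpa using (this.tendsto x).mono_left (nhdsWithin_le_nhds (s := U))
    refine squeeze_zero' (Eventually.of_forall fun _ => norm_nonneg _) ?_ hlim
    filter_upwards [self_mem_nhdsWithin, mem_nhdsWithin_of_mem_nhds (Metric.ball_mem_nhds x hδ)]
      with y hy hyb
    rw [Metric.mem_ball, Real.dist_eq] at hyb
    have hyb' := abs_lt.mp hyb
    rw [Real.norm_eq_abs]
    rcases le_total x y with h | h
    · rw [d.sub_eq_integral hxU hy h, abs_of_nonneg (sub_nonneg.mpr h)]
      · exact abs_integral_le hxU hy h _
      · refine Set.disjoint_left.mpr fun z hz hzJ => absurd (hfar z hzJ) (not_lt.mpr ?_)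
        rw [abs_le]
        constructor <;> linarith [hz.1, hz.2]
    · rw [abs_sub_comm, d.sub_eq_integral hy hxU h, abs_sub_comm, abs_of_nonneg (sub_nonneg.mpr h)]
      · exact abs_integral_le hy hxU h _
      · refine Set.disjoint_left.mpr fun z hz hzJ => absurd (hfar z hzJ) (not_lt.mpr ?_)
        rw [abs_le]
        constructor <;> linarith [hz.1, hz.2]

/-- Step functions on a grid belong to `SBV₂(U)`, with zero derivative. -/
theorem exists_sbv_stepLp {n : ℕ} (hn : 1 ≤ n) (v : ℕ → ℝ) :
    ∃ d : SBV₂ (stepLp n v), d.deriv = 0 := by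
  classical
  obtain ⟨t, ht, hwt, _⟩ := exists_isStep_ae_eq (w := stepOf n v)
    (X := (Finset.range n).image fun κ : ℕ => (κ : ℝ) / n) (G := U)
    (ae_restrict_mem measurableSet_Icc) (by
      intro x hx y hy _ _ hxy hdis
      rw [stepOf_apply hn v hx, stepOf_apply hn v hy]
      congr 1
      refine (cellIndex_mono n hxy).eq_or_lt.resolve_right fun hlt => ?_
      refine Set.disjoint_left.mp hdis ⟨?_, cellIndex_div_le hn hy⟩ (Finset.mem_coe.mpr
        (Finset.mem_image_of_mem _ (Finset.mem_range.mpr (cellIndex_lt hn y))))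
      refine (le_cellIndex_add_one_div hn hx).trans ?_
      gcongr
      exact_mod_cast hlt)
  obtain ⟨d, hd, _⟩ := ht.exists_sbv (f := stepLp n v) (h := 0) (by
    filter_upwards [hwt, coeFn_stepLp n v, ae_restrict_mem measurableSet_Icc] with x h1 h2 hx
    rw [integral_zero_Lp 0 x ⟨le_rfl, zero_le_one⟩ hx hx.1, add_zero, h2, h1])
  exact ⟨d, hd⟩

/-! ### Convergence of the sampling parameter -/

theorem tendsto_sampleSize {A : ℕ → L2U} {f : L2U} (hA : Tendsto A atTop (𝓝 f)) {ι : Type*}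
    {l : Filter ι} {t : ι → ℝ} (ht0 : ∀ s, 0 ≤ t s) (ht : Tendsto t l (𝓝 0))
    [DecidablePred fun t : ℝ => t = 0] :
    Tendsto (fun s => if t s = 0 then f else A (sampleSize (t s))) l (𝓝 f) := by
  have h : Tendsto (fun t : ℝ => if t = 0 then f else A (sampleSize t)) (𝓝[≥] 0) (𝓝 f) := by
    rw [← Ioi_insert, nhdsWithin_insert, tendsto_sup]
    constructor
    · rw [tendsto_pure_left]
      intro V hV
      rw [if_pos rfl]
      exact mem_of_mem_nhds hV
    · have h1 : Tendsto sampleSize (𝓝[>] 0) atTop := by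
        exact tendsto_nat_floor_atTop.comp
          (tendsto_inv_nhdsGT_zero.congr fun x => (one_div x).symm)
      refine (hA.comp h1).congr' ?_
      filter_upwards [self_mem_nhdsWithin] with t ht
      rw [if_neg (ne_of_gt ht)]
      rfl
  exact h.comp (tendsto_nhdsWithin_iff.mpr ⟨ht, Eventually.of_forall ht0⟩)

theorem Cube.param_nonneg (q : Cube) : 0 ≤ q.1.2.2 := by
  rcases q.param_cases with h | ⟨n, _, h⟩ <;> rw [h]
  positivity

theorem Cube.tendsto_components {ι : Type*} {l : Filter ι} {q : ι → Cube} {q₀ : Cube}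
    (hq : Tendsto q l (𝓝 q₀)) : Tendsto (fun s => (q s).1.1) l (𝓝 q₀.1.1) ∧
      Tendsto (fun s => (q s).1.2.1) l (𝓝 q₀.1.2.1) ∧
      Tendsto (fun s => (q s).1.2.2) l (𝓝 q₀.1.2.2) :=
  have hq' : Tendsto (fun s => (q s).1) l (𝓝 q₀.1) := (continuous_subtype_val.tendsto q₀).comp hq
  ⟨hq'.fst_nhds, hq'.snd_nhds.fst_nhds, hq'.snd_nhds.snd_nhds⟩

theorem tendsto_sampledSignal (g : L2U) {ι : Type*} {l : Filter ι} {q : ι → Cube}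
    (ht : Tendsto (fun s => (q s).1.2.2) l (𝓝 0)) :
    Tendsto (fun s => sampledSignal g (q s).1.2.2) l (𝓝 g) := by
  classical
  exact tendsto_sampleSize (tendsto_stepLp_sample g) (fun s => (q s).param_nonneg) ht

/-- The positive sampling parameters are isolated. -/
theorem eventually_param_eq {ι : Type*} {l : Filter ι} {q : ι → Cube} {n : ℕ} (hn : 1 ≤ n)
    (ht : Tendsto (fun s => (q s).1.2.2) l (𝓝 (1 / n))) : ∀ᶠ s in l, (q s).1.2.2 = 1 / n := by
  have hn' : (0 : ℝ) < n := by exact_mod_cast hn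
  have h1 := (ht.inv₀ (by positivity)).sub_const (n : ℝ)
  rw [one_div, inv_inv, sub_self] at h1
  filter_upwards [ht.eventually (lt_mem_nhds (show (0 : ℝ) < 1 / n by positivity)),
    h1.eventually (Ioo_mem_nhds (show (-1 : ℝ) < 0 by norm_num) zero_lt_one)] with s hs1 hs2
  rcases (q s).param_cases with h | ⟨m, hm, h⟩
  · rw [h] at hs1
    exact absurd hs1 (lt_irrefl _)
  · rw [h, one_div, inv_inv] at hs2
    have h3 : m < n + 1 := by
      have := hs2.2
      exact_mod_cast (by linarith : (m : ℝ) < n + 1)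
    have h4 : n < m + 1 := by
      have := hs2.1
      exact_mod_cast (by linarith : (n : ℝ) < m + 1)
    rw [h, show m = n by omega]

/-! ### Semicontinuity of the bond energies -/

section Bond

variable {ι : Type*} {l : Filter ι} {γ μ : ι → ℝ} {γ₀ μ₀ : ℝ}

theorem tendsto_bondEnergy (n : ℕ) {δ : ι → ℝ} {δ₀ : ℝ} (hμ₀ : μ₀ ≠ 0) (hγ : Tendsto γ l (𝓝 γ₀))
    (hμ : Tendsto μ l (𝓝 μ₀)) (hδ : Tendsto δ l (𝓝 δ₀)) :
    Tendsto (fun s => bondEnergy n (γ s) (μ s) (δ s)) l (𝓝 (bondEnergy n γ₀ μ₀ δ₀)) := by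
  have h : Tendsto (fun s => min (n / μ s ^ 2 * δ s ^ 2) (γ s)) l
      (𝓝 (min (n / μ₀ ^ 2 * δ₀ ^ 2) γ₀)) :=
    ((tendsto_const_nhds.div (hμ.pow 2) (pow_ne_zero 2 hμ₀)).mul (hδ.pow 2)).min hγ
  rw [bondEnergy, if_neg hμ₀]
  refine h.congr' ?_
  filter_upwards [hμ.eventually_ne hμ₀] with s hs
  rw [bondEnergy, if_neg hs]

theorem eventually_bondEnergy_le_add {n : ℕ} (hn : 1 ≤ n) {δ : ι → ℝ} {δ₀ : ℝ}
    (hγ0 : ∀ s, 0 ≤ γ s) (hγ : Tendsto γ l (𝓝 γ₀)) (hμ : Tendsto μ l (𝓝 μ₀))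
    (hδ : Tendsto δ l (𝓝 δ₀)) {ε : ℝ} (hε : 0 < ε) :
    ∀ᶠ s in l, bondEnergy n γ₀ μ₀ δ₀ ≤ bondEnergy n (γ s) (μ s) (δ s) + ε := by
  have hn' : (0 : ℝ) < n := by exact_mod_cast hn
  rcases ne_or_eq μ₀ 0 with h0 | rfl
  · filter_upwards [(tendsto_bondEnergy n h0 hγ hμ hδ).eventually
      (lt_mem_nhds (sub_lt_self _ hε))] with s hs
    linarith
  rw [bondEnergy, if_pos rfl]
  split_ifs with hδ₀
  · filter_upwards with s
    linarith [bondEnergy_nonneg n (hγ0 s) (μ s) (δ s)]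
  -- a bond with nonzero increment is eventually in the truncated regime
  have h1 : Tendsto (fun s => n * δ s ^ 2 - γ s * μ s ^ 2) l (𝓝 (n * δ₀ ^ 2 - γ₀ * 0 ^ 2)) :=
    ((hδ.pow 2).const_mul _).sub (hγ.mul (hμ.pow 2))
  have h2 : 0 < n * δ₀ ^ 2 - γ₀ * 0 ^ 2 := by
    have : 0 < δ₀ ^ 2 := by positivity
    have := mul_pos hn' this
    linarith
  filter_upwards [h1.eventually (lt_mem_nhds h2), hδ.eventually_ne hδ₀,
    hγ.eventually (lt_mem_nhds (sub_lt_self _ hε))] with s hs1 hs2 hs3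
  rcases bondEnergy_eq_or n (γ s) (μ s) (δ s) with h | ⟨h, h'⟩
  · linarith
  · have hμs : 0 < μ s ^ 2 := by
      have : μ s ≠ 0 := fun h0 => hs2 (h' h0)
      positivity
    have : γ s ≤ n / μ s ^ 2 * δ s ^ 2 := by
      rw [div_mul_eq_mul_div, le_div_iff₀ hμs]
      linarith
    linarith

theorem eventually_bondEnergy_le (n : ℕ) (δ : ℝ) (hγ0 : ∀ s, 0 ≤ γ s)
    (hγ : Tendsto γ l (𝓝 γ₀)) (hμ : Tendsto μ l (𝓝 μ₀)) {ε : ℝ} (hε : 0 < ε) :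
    ∀ᶠ s in l, bondEnergy n (γ s) (μ s) δ ≤ bondEnergy n γ₀ μ₀ δ + ε := by
  rcases ne_or_eq μ₀ 0 with h0 | rfl
  · filter_upwards [(tendsto_bondEnergy n h0 hγ hμ tendsto_const_nhds).eventually
      (gt_mem_nhds (lt_add_of_pos_right _ hε))] with s hs
    exact hs.le
  rw [bondEnergy, if_pos rfl]
  split_ifs with hδ
  · filter_upwards with s
    have := bondEnergy_le_quadratic n (γ s) (μ := μ s) fun _ => hδ
    rw [hδ, zero_pow two_ne_zero, mul_zero] at this
    rw [hδ]
    linarith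
  · filter_upwards [hγ.eventually (gt_mem_nhds (lt_add_of_pos_right _ hε))] with s hs
    exact (bondEnergy_le n (hγ0 s) _ _).trans hs.le

end Bond

theorem sum_range_le_sum_add {n : ℕ} (hn : 1 ≤ n) {a b : ℕ → ℝ} {ε : ℝ} (hε : 0 < ε)
    (h : ∀ κ ∈ Finset.range (n - 1), a κ ≤ b κ + ε / n) :
    ∑ κ ∈ Finset.range (n - 1), a κ ≤ ∑ κ ∈ Finset.range (n - 1), b κ + ε := by
  have hn' : (0 : ℝ) < n := by exact_mod_cast hn
  refine (Finset.sum_le_sum h).trans ?_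
  rw [Finset.sum_add_distrib, Finset.sum_const, Finset.card_range, nsmul_eq_mul]
  gcongr
  rw [mul_div_assoc', div_le_iff₀ hn', mul_comm]
  gcongr
  omega

/-! ### The lower bound -/

theorem F_le_of_tendsto_of_param_pos {g : L2U} {q : ℕ → Cube} {q₀ : Cube} {l : Filter ℕ} [l.NeBot]
    (hq : Tendsto q l (𝓝 q₀)) {n : ℕ} (hn : 1 ≤ n) (ht₀ : q₀.1.2.2 = 1 / n) {u : ℕ → L2U} {f : L2U}
    (hu : Tendsto u l (𝓝 f)) {c : ℝ} (hc : ∀ᶠ s in l, F g (q s) (u s) ≤ c) : F g q₀ f ≤ c := by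
  obtain ⟨hγ, hμ, ht⟩ := Cube.tendsto_components hq
  rw [ht₀] at ht
  have hte := eventually_param_eq hn ht
  have hdisc : ∀ᶠ s in l, IsDiscrete n (u s) := by
    filter_upwards [hc, hte] with s hs hts
    by_contra hnd
    rw [F_of_not_isDiscrete g hn hts hnd] at hs
    exact absurd hs (not_le.mpr (EReal.coe_lt_top c))
  have hf : IsDiscrete n f := (isClosed_isDiscrete n).mem_of_tendsto hu hdisc
  rw [F_of_isDiscrete g hn ht₀ hf, EReal.coe_le_coe_iff]
  refine le_of_forall_pos_le_add fun ε hε => ?_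
  have hn' : (0 : ℝ) < n := by exact_mod_cast hn
  have hbond : ∀ κ ∈ Finset.range (n - 1), ∀ᶠ s in l,
      bondEnergy n q₀.1.1 q₀.1.2.1 (sample n f (κ + 1) - sample n f κ)
        ≤ bondEnergy n (q s).1.1 (q s).1.2.1 (sample n (u s) (κ + 1) - sample n (u s) κ)
          + ε / n := by
    intro κ hκ
    have := Finset.mem_range.mp hκ
    exact eventually_bondEnergy_le_add hn (fun s => (q s).2.1) hγ hμ
      ((((continuous_sample (show κ + 1 < n by omega)).tendsto f).comp hu).sub
        (((continuous_sample (show κ < n by omega)).tendsto f).comp hu)) (by positivity)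
  have hlim : Tendsto (fun s => gridEnergy n q₀.1.1 q₀.1.2.1 f
      + ‖u s - sampledSignal g q₀.1.2.2‖ ^ 2) l (𝓝 (gridEnergy n q₀.1.1 q₀.1.2.1 f
      + ‖f - sampledSignal g q₀.1.2.2‖ ^ 2)) :=
    tendsto_const_nhds.add ((hu.sub_const _).norm.pow 2)
  refine le_of_tendsto hlim ?_
  filter_upwards [hc, hte, hdisc, (Filter.eventually_all_finset _).mpr hbond] with s h1 h2 h3 h4
  rw [F_of_isDiscrete g hn h2 h3, EReal.coe_le_coe_iff, h2, ← ht₀] at h1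
  have : gridEnergy n q₀.1.1 q₀.1.2.1 f
      ≤ gridEnergy n (q s).1.1 (q s).1.2.1 (u s) + ε := sum_range_le_sum_add hn hε h4
  linarith

/-- The lower bound in the continuum limit with `γ > 0`. All four kinds of functionals near the limit
are treated alike, through their approximate primitives. -/
theorem F_le_of_tendsto_of_param_zero {g : L2U} {q : ℕ → Cube} {q₀ : Cube} {𝒰 : Ultrafilter ℕ}
    (hq : Tendsto q 𝒰 (𝓝 q₀)) (ht₀ : q₀.1.2.2 = 0) (hγ₀ : 0 < q₀.1.1) {u : ℕ → L2U} {f : L2U}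
    (hu : Tendsto u 𝒰 (𝓝 f))
    (hae : ∀ᵐ x ∂(volume.restrict U), Tendsto (fun s => u s x) 𝒰 (𝓝 (f x)))
    {c : ℝ} (hc : ∀ᶠ s in 𝒰, F g (q s) (u s) ≤ c) : F g q₀ f ≤ c := by
  obtain ⟨hγ, hμ, ht⟩ := Cube.tendsto_components hq
  rw [ht₀] at ht
  have hex : ∀ s, ∃ (r : ℝ → ℝ) (J : Finset ℝ) (h : L2U), 0 < (q s).1.1 → F g (q s) (u s) ≤ c →
      (∀ᵐ x ∂(volume.restrict U), u s x = r x) ∧ (J : Set ℝ) ⊆ U ∧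
      (∀ x ∈ U, ∀ y ∈ U, x ≤ y → Disjoint (Icc x y) (J : Set ℝ) →
        |r y - r x - ∫ z in x..y, h z| ≤ 2 * ‖h‖ * √(q s).1.2.2) ∧
      ((q s).1.2.1 = 0 → h = 0) ∧ (q s).1.1 * J.card + 1 / (q s).1.2.1 ^ 2 * ‖h‖ ^ 2
        + ‖u s - sampledSignal g (q s).1.2.2‖ ^ 2 ≤ c := by
    intro s
    by_cases h1 : 0 < (q s).1.1 ∧ F g (q s) (u s) ≤ c
    · obtain ⟨r, J, h, hall⟩ := exists_approx_primitive_of_F_le h1.1 h1.2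
      exact ⟨r, J, h, fun _ _ => hall⟩
    · exact ⟨0, ∅, 0, fun h2 h3 => absurd ⟨h2, h3⟩ h1⟩
  choose r J h hall using hex
  have hgood : ∀ᶠ s in 𝒰, 0 < (q s).1.1 ∧ F g (q s) (u s) ≤ c :=
    (hγ.eventually (lt_mem_nhds hγ₀)).and hc
  have hJ : ∀ᶠ s in 𝒰, (J s : Set ℝ) ⊆ U := hgood.mono fun s hs => (hall s hs.1 hs.2).2.1
  have hle : ∀ᶠ s in 𝒰, (q s).1.1 * (J s).card + 1 / (q s).1.2.1 ^ 2 * ‖h s‖ ^ 2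
      + ‖u s - sampledSignal g (q s).1.2.2‖ ^ 2 ≤ c :=
    hgood.mono fun s hs => (hall s hs.1 hs.2).2.2.2.2
  -- the number of jumps is constant along the ultrafilter
  obtain ⟨N, -, hN⟩ : ∃ N ∈ Set.Iic ⌊c / (q₀.1.1 / 2)⌋₊, ∀ᶠ s in 𝒰, (J s).card = N := by
    rw [← Ultrafilter.eventually_exists_mem_iff (Set.finite_Iic _)]
    filter_upwards [hle, hγ.eventually (lt_mem_nhds (half_lt_self hγ₀))] with s h1 h2
    refine ⟨_, mem_Iic.mpr (Nat.le_floor ?_), rfl⟩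
    rw [le_div_iff₀ (half_pos hγ₀)]
    have h3 : 0 ≤ 1 / (q s).1.2.1 ^ 2 * ‖h s‖ ^ 2 := by positivity
    have h4 : q₀.1.1 / 2 * (J s).card ≤ (q s).1.1 * (J s).card := by gcongr
    have h5 := sq_nonneg ‖u s - sampledSignal g (q s).1.2.2‖
    linarith
  have hh : ∀ᶠ s in 𝒰, ‖h s‖ ≤ √c * (q s).1.2.1 := by
    filter_upwards [hle, hgood] with s h1 h2
    have h3 : 0 ≤ (q s).1.1 * (J s).card := mul_nonneg h2.1.le (Nat.cast_nonneg _)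
    have h4 := sq_nonneg ‖u s - sampledSignal g (q s).1.2.2‖
    have h5 : 1 / (q s).1.2.1 ^ 2 * ‖h s‖ ^ 2 ≤ c := by linarith
    rcases (q s).2.2.1.eq_or_lt with h0 | h0
    · rw [(hall s h2.1 h2.2).2.2.2.1 h0.symm, norm_zero, ← h0, mul_zero]
    · rw [one_div_mul_eq_div, ← div_pow] at h5
      rw [← div_le_iff₀ h0]
      exact Real.le_sqrt_of_sq_le h5
  have hlimμ := hμ.const_mul √c
  obtain ⟨β, -, hβ⟩ : ∃ β ∈ Icc 0 (√c * q₀.1.2.1 + 1), Tendsto (fun s => ‖h s‖) 𝒰 (𝓝 β) := by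
    refine isCompact_Icc.ultrafilter_le_nhds (𝒰.map fun s => ‖h s‖) ?_
    rw [le_principal_iff, Ultrafilter.mem_coe, Ultrafilter.mem_map]
    filter_upwards [hh, hlimμ.eventually (gt_mem_nhds (lt_add_one _))] with s h1 h2
    exact ⟨norm_nonneg _, h1.trans h2.le⟩
  have he : Tendsto (fun s => 2 * ‖h s‖ * √(q s).1.2.2) 𝒰 (𝓝 0) := by
    simpa using (hβ.const_mul 2).mul ht.sqrt
  have hrae : ∀ᵐ x ∂(volume.restrict U), Tendsto (fun s => r s x) 𝒰 (𝓝 (f x)) := by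
    have h1 : ∀ᵐ x ∂(volume.restrict U), ∀ s, 0 < (q s).1.1 → F g (q s) (u s) ≤ c →
        u s x = r s x := by
      refine ae_all_iff.mpr fun s => ?_
      by_cases h2 : 0 < (q s).1.1 ∧ F g (q s) (u s) ≤ c
      · filter_upwards [(hall s h2.1 h2.2).1] with x hx _ _
        exact hx
      · exact Eventually.of_forall fun x h3 h4 => absurd ⟨h3, h4⟩ h2
    filter_upwards [hae, h1] with x hx1 hx2
    refine hx1.congr' ?_
    filter_upwards [hgood] with s hs
    exact hx2 s hs.1 hs.2
  obtain ⟨d, hdN, hdβ⟩ := exists_sbv_of_tendsto hJ (hN.mono fun s hs => hs.le) hβ he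
    (hgood.mono fun s hs => (hall s hs.1 hs.2).2.2.1) hrae
  have hfid : Tendsto (fun s => ‖u s - sampledSignal g (q s).1.2.2‖ ^ 2) 𝒰 (𝓝 (‖f - g‖ ^ 2)) :=
    (hu.sub (tendsto_sampledSignal g ht)).norm.pow 2
  have hdN' : q₀.1.1 * d.jumps.card ≤ q₀.1.1 * N := by gcongr
  rcases q₀.2.2.1.eq_or_lt with h0 | h0
  · have hβ0 : β ≤ 0 := by
      refine (le_of_tendsto_of_tendsto hβ hlimμ hh).trans_eq ?_
      rw [← h0, mul_zero]
    have hd0 : d.deriv = 0 := norm_le_zero_iff.mp (hdβ.trans hβ0)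
    refine (F_le_of_sbv ht₀ d fun _ => hd0).trans (EReal.coe_le_coe_iff.mpr ?_)
    rw [hd0, norm_zero, zero_pow two_ne_zero, mul_zero, add_zero]
    have hlim : Tendsto (fun s => (q s).1.1 * N + ‖u s - sampledSignal g (q s).1.2.2‖ ^ 2) 𝒰
        (𝓝 (q₀.1.1 * N + ‖f - g‖ ^ 2)) := (hγ.mul_const _).add hfid
    have := le_of_tendsto hlim (by
      filter_upwards [hle, hN] with s h1 h2
      rw [h2] at h1
      have h3 : 0 ≤ 1 / (q s).1.2.1 ^ 2 * ‖h s‖ ^ 2 := by positivity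
      linarith)
    linarith
  · refine (F_le_of_sbv ht₀ d fun h1 => absurd h1 h0.ne').trans (EReal.coe_le_coe_iff.mpr ?_)
    have hlim : Tendsto (fun s => (q s).1.1 * N + 1 / (q s).1.2.1 ^ 2 * ‖h s‖ ^ 2
        + ‖u s - sampledSignal g (q s).1.2.2‖ ^ 2) 𝒰
        (𝓝 (q₀.1.1 * N + 1 / q₀.1.2.1 ^ 2 * β ^ 2 + ‖f - g‖ ^ 2)) :=
      ((hγ.mul_const _).add ((tendsto_const_nhds.div (hμ.pow 2) (pow_ne_zero 2 h0.ne')).mul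
        (hβ.pow 2))).add hfid
    have h1 := le_of_tendsto hlim (by
      filter_upwards [hle, hN] with s h1 h2
      rwa [h2] at h1)
    have h2 : 1 / q₀.1.2.1 ^ 2 * ‖d.deriv‖ ^ 2 ≤ 1 / q₀.1.2.1 ^ 2 * β ^ 2 := by gcongr
    linarith

theorem F_le_liminf {g : L2U} {q : ℕ → Cube} {q₀ : Cube} (hq : Tendsto q atTop (𝓝 q₀)) {f : L2U}
    {u : ℕ → L2U} (hu : Tendsto u atTop (𝓝 f)) :
    F g q₀ f ≤ liminf (fun s => F g (q s) (u s)) atTop := by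
  by_contra! hlt
  obtain ⟨c, hc1, hc2⟩ := EReal.lt_iff_exists_real_btwn.mp hlt
  obtain ⟨𝒰, hle, hP, hae⟩ := exists_ultrafilter_tendsto_ae hu
    (frequently_lt_of_liminf_lt (by isBoundedDefault) hc1)
  have hP : ∀ᶠ s in 𝒰, F g (q s) (u s) ≤ c := hP.mono fun s hs => hs.le
  have hq := hq.mono_left hle
  have hu := hu.mono_left hle
  refine absurd hc2 (not_lt.mpr ?_)
  rcases q₀.param_cases with ht₀ | ⟨n, hn, ht₀⟩
  · rcases q₀.2.1.eq_or_lt with h0 | h0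
    · rw [F_eq_distance g h0.symm ht₀, EReal.coe_le_coe_iff]
      have ht := (Cube.tendsto_components hq).2.2
      rw [ht₀] at ht
      exact le_of_tendsto ((hu.sub (tendsto_sampledSignal g ht)).norm.pow 2)
        (hP.mono fun s hs => norm_sq_le_of_F_le hs)
    · exact F_le_of_tendsto_of_param_zero hq ht₀ h0 hu hae hP
  · exact F_le_of_tendsto_of_param_pos hq hn ht₀ hu hP

/-! ### Recovery sequences -/

/-- A diagonal argument: approximate recovery up to every `ε > 0` yields a recovery sequence. -/
theorem exists_seq_limsup_le {X : Type*} [MetricSpace X] {Fs : ℕ → X → EReal} {x : X} {c : ℝ}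
    (h : ∀ ε > 0, ∀ᶠ s in atTop, ∃ u, dist u x < ε ∧ Fs s u ≤ ((c + ε : ℝ) : EReal)) :
    ∃ u : ℕ → X, Tendsto u atTop (𝓝 x) ∧ limsup (fun s => Fs s (u s)) atTop ≤ c := by
  -- the admissible errors at the index `s`; `u s` almost realizes the smallest one
  let A : ℕ → Set ℝ := fun s => {ε | 0 < ε ∧ ∃ u, dist u x < ε ∧ Fs s u ≤ ((c + ε : ℝ) : EReal)}
  have hbdd : ∀ s, BddBelow (A s) := fun s => ⟨0, fun ε hε => hε.1.le⟩
  have hex : ∀ s, ∃ (e : ℝ) (u : X), (A s).Nonempty → 0 < e ∧ e < sInf (A s) + 1 / (s + 1) ∧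
      dist u x < e ∧ Fs s u ≤ ((c + e : ℝ) : EReal) := by
    intro s
    by_cases hA : (A s).Nonempty
    · obtain ⟨e, ⟨he, u, hu⟩, hlt⟩ := exists_lt_of_csInf_lt hA
        (lt_add_of_pos_right (sInf (A s)) (Nat.one_div_pos_of_nat (α := ℝ) (n := s)))
      exact ⟨e, u, fun _ => ⟨he, hlt, hu⟩⟩
    · exact ⟨0, x, fun h => absurd h hA⟩
  choose e u heu using hex
  have hev : ∀ ε > 0, ∀ᶠ s in atTop, ε ∈ A s := fun ε hε => (h ε hε).mono fun s hs => ⟨hε, hs⟩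
  have hne : ∀ᶠ s in atTop, (A s).Nonempty := (hev 1 one_pos).mono fun s hs => ⟨1, hs⟩
  have he : Tendsto e atTop (𝓝 0) := by
    rw [Metric.tendsto_nhds]
    intro ε hε
    filter_upwards [hev (ε / 2) (half_pos hε), (tendsto_one_div_add_atTop_nhds_zero_nat
      (𝕜 := ℝ)).eventually (gt_mem_nhds (half_pos hε))] with s h1 h2
    obtain ⟨h3, h4, _⟩ := heu s ⟨_, h1⟩
    have := csInf_le (hbdd s) h1
    rw [Real.dist_0_eq_abs, abs_of_pos h3]
    linarith
  refine ⟨u, ?_, ?_⟩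
  · rw [tendsto_iff_dist_tendsto_zero]
    refine squeeze_zero' (Eventually.of_forall fun _ => dist_nonneg) ?_ he
    filter_upwards [hne] with s hs
    exact (heu s hs).2.2.1.le
  · have hlim : Tendsto (fun s => ((c + e s : ℝ) : EReal)) atTop (𝓝 (c : EReal)) := by
      refine (continuous_coe_real_ereal.tendsto c).comp ?_
      simpa using tendsto_const_nhds.add he
    rw [← hlim.limsup_eq]
    refine limsup_le_limsup ?_
    filter_upwards [hne] with s hs
    exact (heu s hs).2.2.2

open Classical in
/-- The recovery candidate at the sampling parameter `t`: `f` itself for `t = 0`, point samples of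
`f` for `t = 1/n`. -/
noncomputable def SBV₂.recovery {f : L2U} (d : SBV₂ f) (t : ℝ) : L2U :=
  if t = 0 then f else d.gridSample (sampleSize t)

theorem SBV₂.F_recovery_le {f : L2U} (d : SBV₂ f) (g : L2U) {q : Cube}
    (hd : q.1.2.1 = 0 → d.deriv = 0) : F g q (d.recovery q.1.2.2)
      ≤ ((q.1.1 * d.jumps.card + 1 / q.1.2.1 ^ 2 * ‖d.deriv‖ ^ 2
        + ‖d.recovery q.1.2.2 - sampledSignal g q.1.2.2‖ ^ 2 : ℝ) : EReal) := by
  rcases q.param_cases with ht | ⟨n, hn, ht⟩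
  · have h1 : d.recovery q.1.2.2 = f := if_pos ht
    rw [h1]
    conv_rhs => rw [ht, sampledSignal_zero]
    exact F_le_of_sbv ht d hd
  · have hn' : (n : ℝ) ≠ 0 := by exact_mod_cast (show n ≠ 0 by omega)
    have h1 : d.recovery q.1.2.2 = d.gridSample n := by
      rw [recovery, ht, if_neg (one_div_ne_zero hn'), sampleSize_one_div]
    rw [h1, F_of_isDiscrete g hn ht (f := d.gridSample n) (isDiscrete_iff.mpr ⟨_, rfl⟩),
      EReal.coe_le_coe_iff]
    gcongr
    exact d.gridEnergy_le q.2.1 hd n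

/-- Recovery in the continuum limit of functions in `SBV₂(U)`. -/
theorem SBV₂.eventually_F_recovery_le {w : L2U} (d : SBV₂ w) (g : L2U) {q : ℕ → Cube} {q₀ : Cube}
    (hq : Tendsto q atTop (𝓝 q₀)) (ht₀ : q₀.1.2.2 = 0) (hd : q₀.1.2.1 = 0 → d.deriv = 0) {ε : ℝ}
    (hε : 0 < ε) : ∀ᶠ s in atTop, ∃ u, dist u w < ε ∧ F g (q s) u
      ≤ ((q₀.1.1 * d.jumps.card + 1 / q₀.1.2.1 ^ 2 * ‖d.deriv‖ ^ 2 + ‖w - g‖ ^ 2 + ε : ℝ)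
        : EReal) := by
  classical
  obtain ⟨hγ, hμ, ht⟩ := Cube.tendsto_components hq
  rw [ht₀] at ht
  have hrec : Tendsto (fun s => d.recovery (q s).1.2.2) atTop (𝓝 w) :=
    tendsto_sampleSize d.tendsto_gridSample (fun s => (q s).param_nonneg) ht
  have hderiv : Tendsto (fun s => 1 / (q s).1.2.1 ^ 2 * ‖d.deriv‖ ^ 2) atTop
      (𝓝 (1 / q₀.1.2.1 ^ 2 * ‖d.deriv‖ ^ 2)) := by
    by_cases h0 : q₀.1.2.1 = 0
    · simp [hd h0]
    · exact (tendsto_const_nhds.div (hμ.pow 2) (pow_ne_zero 2 h0)).mul_const _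
  have hd' : ∀ᶠ s in atTop, (q s).1.2.1 = 0 → d.deriv = 0 := by
    by_cases h0 : q₀.1.2.1 = 0
    · exact Eventually.of_forall fun _ _ => hd h0
    · exact (hμ.eventually_ne h0).mono fun s hs h => absurd h hs
  have hlim := ((hγ.mul_const (d.jumps.card : ℝ)).add hderiv).add
    ((hrec.sub (tendsto_sampledSignal g ht)).norm.pow 2)
  filter_upwards [hd', Metric.tendsto_nhds.mp hrec ε hε,
    hlim.eventually (gt_mem_nhds (lt_add_of_pos_right _ hε))] with s h1 h2 h3
  exact ⟨_, h2, (d.F_recovery_le g h1).trans (EReal.coe_le_coe_iff.mpr h3.le)⟩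

theorem eventually_exists_F_le {g : L2U} {q : ℕ → Cube} {q₀ : Cube}
    (hq : Tendsto q atTop (𝓝 q₀)) {f : L2U} {c : ℝ} (hc : F g q₀ f ≤ c) {ε : ℝ} (hε : 0 < ε) :
    ∀ᶠ s in atTop, ∃ u, dist u f < ε ∧ F g (q s) u ≤ ((c + ε : ℝ) : EReal) := by
  rcases q₀.param_cases with ht₀ | ⟨n, hn, ht₀⟩
  · rcases q₀.2.1.eq_or_lt with h0 | h0
    · -- for `γ = 0` step functions of finite, but arbitrary, jump number approximate the signal
      rw [F_eq_distance g h0.symm ht₀, EReal.coe_le_coe_iff] at hc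
      have hA := tendsto_stepLp_sample f
      obtain ⟨N, hN1, hN2, hN3⟩ := ((Metric.tendsto_nhds.mp hA (ε / 2) (half_pos hε)).and
        ((((hA.sub_const g).norm.pow 2).eventually
          (gt_mem_nhds (lt_add_of_pos_right _ (half_pos hε)))).and (eventually_ge_atTop 1))).exists
      obtain ⟨d, hd⟩ := exists_sbv_stepLp hN3 (sample N f)
      filter_upwards [d.eventually_F_recovery_le g hq ht₀ (fun _ => hd) (half_pos hε)]
        with s ⟨u, hu1, hu2⟩
      refine ⟨u, (dist_triangle _ _ _).trans_lt (by linarith), hu2.trans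
        (EReal.coe_le_coe_iff.mpr ?_)⟩
      rw [← h0, hd, norm_zero]
      linarith
    · obtain ⟨d, hd, hle⟩ := exists_sbv_of_F_le h0 ht₀ hc
      filter_upwards [d.eventually_F_recovery_le g hq ht₀ hd hε] with s ⟨u, hu1, hu2⟩
      exact ⟨u, hu1, hu2.trans (EReal.coe_le_coe_iff.mpr (by linarith))⟩
  · have hn' : (0 : ℝ) < n := by exact_mod_cast hn
    have hf : IsDiscrete n f := by
      by_contra hnd
      rw [F_of_not_isDiscrete g hn ht₀ hnd] at hc
      exact absurd hc (not_le.mpr (EReal.coe_lt_top c))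
    rw [F_of_isDiscrete g hn ht₀ hf, EReal.coe_le_coe_iff] at hc
    obtain ⟨hγ, hμ, ht⟩ := Cube.tendsto_components hq
    rw [ht₀] at ht
    have hbond : ∀ κ ∈ Finset.range (n - 1), ∀ᶠ s in atTop,
        bondEnergy n (q s).1.1 (q s).1.2.1 (sample n f (κ + 1) - sample n f κ)
          ≤ bondEnergy n q₀.1.1 q₀.1.2.1 (sample n f (κ + 1) - sample n f κ) + ε / n :=
      fun κ _ => eventually_bondEnergy_le n _ (fun s => (q s).2.1) hγ hμ
        (by positivity)
    filter_upwards [eventually_param_eq hn ht, (Filter.eventually_all_finset _).mpr hbond]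
      with s h1 h2
    refine ⟨f, by rwa [dist_self], ?_⟩
    rw [F_of_isDiscrete g hn h1 hf, EReal.coe_le_coe_iff, h1, ← ht₀]
    have : gridEnergy n (q s).1.1 (q s).1.2.1 f
        ≤ gridEnergy n q₀.1.1 q₀.1.2.1 f + ε := sum_range_le_sum_add hn hε h2
    linarith

theorem exists_recovery_seq {g : L2U} {q : ℕ → Cube} {q₀ : Cube} (hq : Tendsto q atTop (𝓝 q₀))
    (f : L2U) : ∃ u : ℕ → L2U, Tendsto u atTop (𝓝 f) ∧
      limsup (fun s => F g (q s) (u s)) atTop ≤ F g q₀ f := by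
  rcases eq_or_ne (F g q₀ f) ⊤ with htop | htop
  · exact ⟨fun _ => f, tendsto_const_nhds, htop ▸ le_top⟩
  have hbot : F g q₀ f ≠ ⊥ := by
    intro h
    have h1 := norm_sq_le_of_F_le (g := g) (q := q₀) (f := f) (c := -1) (h ▸ bot_le)
    linarith [sq_nonneg ‖f - sampledSignal g q₀.1.2.2‖]
  lift F g q₀ f to ℝ using ⟨htop, hbot⟩ with c hc
  exact exists_seq_limsup_le fun ε hε => eventually_exists_F_le hq hc.ge hε

end Segmentation

theorem theorem6p2 (g : Segmentation.L2U) (q : ℕ → Segmentation.Cube) (q₀ : Segmentation.Cube)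
    (hq : Filter.Tendsto q Filter.atTop (nhds q₀)) :
    Segmentation.GammaConverges (fun s => Segmentation.F g (q s)) (Segmentation.F g q₀) :=
  ⟨fun _ _ hu => Segmentation.F_le_liminf hq hu, fun f => Segmentation.exists_recovery_seq hq f⟩
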